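/- Let $\varphi:(0,\infty)\to(0,\infty)$ satisfy: (i) $\varphi\in C^1((0,\infty))$; (ii) $(s\varphi(s))'>0$ for all $s>0$; (iii) the range of $s\mapsto s\varphi(s)$ is $(0,\infty)$; (iv) there are $C_1,C_2,s_0>0$ and $r>-1$ with $C_1s^r\le (s\varphi(s))'\le C_2s^r$ for $s\in(0,s_0)$, and if $r=0$ then moreover $\lim_{s\to0^+}\varphi(s)$ exists, is finite and positive, and $\lim_{s\to0^+}s\varphi'(s)=0$; (v) for some $s_1>s_0$, either $\varphi'(s)\ge0$ for all $s\ge s_1$ or $\varphi'(s)\le 0$ for all $s\ge s_1$; (vi) $s\mapsto|s\varphi'(s)/\varphi(s)|$ is non-decreasing on $(0,\infty)$. Let $\Lambda:(0,\infty)\to\mathbb R$ be the function defined by $$\Lambda\big(s\sqrt{\varphi(s)}\big)=-\frac{s\varphi'(s)}{s\varphi'(s)+2\varphi(s)}\qquad(s>0),$$ put $\Lambda_\infty^2=\sup_{t>0}\Lambda^2(t)$, and assume $\Lambda_\infty^2<1$. Let $-\infty\le a<b\le\infty$ and $m\ge1$. For an $m\times m$ matrix $\mathscr B$ with entries in $L^1_{\mathrm{loc}}((a,b);\mathbb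 C)$, the operator $u\mapsto(\mathscr Bu')'$ is called $L^\Phi$-dissipative if $$\operatorname{Re}\int_a^b\langle\mathscr B u',(\varphi(|u|)u)'\rangle\,dx\ge0$$ for every $u\in[C^1_c((a,b))]^m$ (complex valued) such that $\varphi(|u|)u\in[C^1_c((a,b))]^m$ (where $\varphi(|u|)u:=0$ at the zeros of $u$). Let $\mathscr A$ be a real $m\times m$ matrix function on $(a,b)$, with entries in $L^1_{\mathrm{loc}}((a,b))$ and symmetric almost everywhere, let $\mu_1(x)$ and $\mu_m(x)$ be the smallest and the largest eigenvalue of $\mathscr A(x)$, and let $Au=(\mathscr Au')'$. Then there exists $\kappa>0$ such that $A-\kappa I\,d^2/dx^2$, i.e. $u\mapsto((\mathscr A-\kappa I)u')'$, is $L^\Phi$-dissipative if and only if $$\operatorname*{ess\,inf}_{x\in(a,b)}\Big[\big(1+\sqrt{1-\Lambda_\infty^2}\big)\mu_1(x)-\big(1-\sqrt{1-\Lambda_\infty^2}\big)\mu_m(x)\Big]>0. \tag{1}$$ If $m=2$, condition (1) is equivalent to $$\operatorname*{ess\,inf}_{x\in(a,b)}\Big[\sqrt{1-\Lambda_\infty^2}\,\operatorname{tr}\mathscr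 A(x)-\sqrt{(\operatorname{tr}\mathscr A(x))^2-4\det\mathscr A(x)}\Big]>0.$$ -/

import Mathlib

open MeasureTheory Set Filter Topology

namespace FunctionalDissipativity

/-- The standing assumptions on the positive function `φ : (0, ∞) → (0, ∞)`
(values of `φ` outside `(0, ∞)` are irrelevant). -/
structure IsAdmissible (φ : ℝ → ℝ) : Prop where
  pos : ∀ s, 0 < s → 0 < φ s
  contDiffOn : ContDiffOn ℝ 1 φ (Ioi 0)
  deriv_pos : ∀ s, 0 < s → 0 < deriv (fun t => t * φ t) s
  range_eq : (fun s => s * φ s) '' Ioi 0 = Ioi 0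
  /-- Power behaviour of `(s φ(s))'` at `0`, and constant sign of `φ'` near infinity. -/
  growth : ∃ C₁ C₂ r s₀ : ℝ, 0 < C₁ ∧ 0 < C₂ ∧ -1 < r ∧ 0 < s₀ ∧
    (∀ s ∈ Ioo 0 s₀, C₁ * s ^ r ≤ deriv (fun t => t * φ t) s ∧
      deriv (fun t => t * φ t) s ≤ C₂ * s ^ r) ∧
    (r = 0 → (∃ φ₀ : ℝ, 0 < φ₀ ∧ Tendsto φ (𝓝[>] 0) (𝓝 φ₀)) ∧
      Tendsto (fun s => s * deriv φ s) (𝓝[>] 0) (𝓝 0)) ∧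
    ∃ s₁ : ℝ, s₀ < s₁ ∧
      ((∀ s, s₁ ≤ s → 0 ≤ deriv φ s) ∨ (∀ s, s₁ ≤ s → deriv φ s ≤ 0))
  monotone_abs : MonotoneOn (fun s => |s * deriv φ s / φ s|) (Ioi 0)

/-- `- s φ'(s) / (s φ'(s) + 2 φ(s))`. -/
noncomputable def lambdaRatio (φ : ℝ → ℝ) (s : ℝ) : ℝ :=
  -((s * deriv φ s) / (s * deriv φ s + 2 * φ s))

/-- The function `Λ` on `(0, ∞)`, determined by
`Λ (s √φ(s)) = - s φ'(s) / (s φ'(s) + 2 φ(s))` for `s > 0` (see `Lambda_apply`). -/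
noncomputable def Lambda (φ : ℝ → ℝ) (t : ℝ) : ℝ :=
  lambdaRatio φ (Function.invFunOn (fun s => s * √(φ s)) (Ioi 0) t)

/-- `Λ_∞² = sup_{t > 0} Λ(t)²`. -/
noncomputable def LambdaInftySq (φ : ℝ → ℝ) : ℝ :=
  ⨆ t : Ioi (0 : ℝ), Lambda φ t ^ 2

theorem IsAdmissible.injOn {φ : ℝ → ℝ} (h : IsAdmissible φ) :
    InjOn (fun s => s * √(φ s)) (Ioi 0) := by
  have hc : ContinuousOn (fun s => s * φ s) (Ioi 0) :=
    continuousOn_id.mul h.contDiffOn.continuousOn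
  have hm : StrictMonoOn (fun s => s * φ s) (Ioi 0) := by
    apply strictMonoOn_of_deriv_pos (convex_Ioi 0) hc
    intro x hx
    rw [interior_Ioi] at hx
    exact h.deriv_pos x hx
  have hs : StrictMonoOn (fun s => s * √(φ s)) (Ioi 0) := by
    intro x hx y hy hxy
    have hx' : 0 < x := hx
    have hy' : 0 < y := hy
    have h1 : x * φ x < y * φ y := hm hx hy hxy
    have h2 : 0 < x * φ x := mul_pos hx' (h.pos x hx')
    have h3 : x * (x * φ x) < y * (y * φ y) := mul_lt_mul'' hxy h1 hx'.le h2.le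
    have e : ∀ z, 0 < z → z * √(φ z) = √(z * (z * φ z)) := by
      intro z hz
      rw [← mul_assoc, Real.sqrt_mul (mul_self_nonneg z), Real.sqrt_mul_self hz.le]
    change x * √(φ x) < y * √(φ y)
    rw [e x hx', e y hy']
    exact Real.sqrt_lt_sqrt (mul_pos hx' h2).le h3
  exact hs.injOn

/-- The defining relation of `Λ`. -/
theorem Lambda_apply {φ : ℝ → ℝ} (h : IsAdmissible φ) {s : ℝ} (hs : 0 < s) :
    Lambda φ (s * √(φ s)) = -((s * deriv φ s) / (s * deriv φ s + 2 * φ s)) := by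
  have : Function.invFunOn (fun s => s * √(φ s)) (Ioi 0) (s * √(φ s)) = s :=
    h.injOn.leftInvOn_invFunOn hs
  simp only [Lambda, lambdaRatio, this]

/-- `w ∈ [C¹_c(I)]^m`, functions on the open set `I` being extended by zero. -/
def IsC1c {m : ℕ} (I : Set ℝ) (w : ℝ → EuclideanSpace ℂ (Fin m)) : Prop :=
  ContDiff ℝ 1 w ∧ HasCompactSupport w ∧ tsupport w ⊆ I

/-- `L^Φ`-dissipativity of the ordinary differential operator `u ↦ (B u')'` on the open interval
`I`: `Re ∫_I ⟨B u', (φ(|u|) u)'⟩ dx ≥ 0` for all `u ∈ [C¹_c(I)]^m` with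
`φ(|u|) u ∈ [C¹_c(I)]^m`. (Mathlib's `inner` is linear in its second argument.) -/
def IsLPhiDissipative {m : ℕ} (φ : ℝ → ℝ) (I : Set ℝ)
    (B : ℝ → Matrix (Fin m) (Fin m) ℂ) : Prop :=
  ∀ u : ℝ → EuclideanSpace ℂ (Fin m),
    IsC1c I u → IsC1c I (fun x => φ ‖u x‖ • u x) →
    0 ≤ (∫ x in I, inner ℂ (deriv (fun y => φ ‖u y‖ • u y) x)
      (Matrix.toEuclideanLin (B x) (deriv u x))).re

/-- The smallest (real) eigenvalue of a matrix. -/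
noncomputable def minEigenvalue {m : ℕ} (M : Matrix (Fin m) (Fin m) ℝ) : ℝ :=
  sInf {μ : ℝ | Module.End.HasEigenvalue (Matrix.toLin' M) μ}

/-- The largest (real) eigenvalue of a matrix. -/
noncomputable def maxEigenvalue {m : ℕ} (M : Matrix (Fin m) (Fin m) ℝ) : ℝ :=
  sSup {μ : ℝ | Module.End.HasEigenvalue (Matrix.toLin' M) μ}

/-- The bounded or unbounded open interval `(a, b)` with `-∞ ≤ a, b ≤ ∞`. -/
def openInterval (a b : EReal) : Set ℝ :=
  {x : ℝ | a < (x : EReal) ∧ (x : EReal) < b}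

/-- The essential infimum over `I`, with values in `[-∞, ∞]`, of a real function. -/
noncomputable def essInfOn (I : Set ℝ) (f : ℝ → ℝ) : EReal :=
  essInf (fun x => (f x : EReal)) (volume.restrict I)

end FunctionalDissipativity

/-!
Write `g = s φ'(s) / φ(s)` and `τ = √(1 - Λ_∞²)`. At a point `s w` with `|w| = 1` the derivative of
`y ↦ φ(|y|) y` is `φ(s)` times `v ↦ v + g ⟪w, v⟫ w`, which is `1 + g / 2` times the identity plus
`g / 2` times a reflection; so it turns every vector by an angle of sine at most
`|g| / (g + 2) = |Λ|`. A symmetric matrix with extreme eigenvalues `0 ≤ p ≤ q` lies within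
`(q - p) / 2` of `(p + q) / 2` times the identity, so it turns every vector by an angle of sine at
most `(q - p) / (p + q)`. The two images of `v` always have a nonnegative inner product exactly when
the two largest angles add up to at most `π / 2`, that is when `q - p ≤ τ (p + q)`, or
`0 ≤ (1 + τ) p - (1 - τ) q`.

Dissipativity is equivalent to this pointwise condition almost everywhere. By the chain rule the
pointwise condition is sufficient. For necessity, add to a test function that is constant near a
Lebesgue point of the coefficients narrow spikes of small height and unbounded energy: the integral
then localizes at that point.

Replacing the matrix by its difference with `κ I` lowers `(1 + τ) p - (1 - τ) q` by `2 τ κ`, which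
makes room for some `κ > 0` exactly when the essential infimum is positive.
-/

namespace FunctionalDissipativity

open scoped InnerProductSpace

section Angles

variable {F : Type*} [NormedAddCommGroup F] [InnerProductSpace ℝ F]

theorem angle_le_arcsin_of_norm_sub_smul_le {a x : F} {c σ : ℝ} (ha : a ≠ 0) (hx : x ≠ 0)
    (hc : 0 ≤ c) (hσ₀ : 0 ≤ σ) (hσ₁ : σ ≤ 1) (h : ‖a - c • x‖ ≤ σ * (c * ‖x‖)) :
    InnerProductGeometry.angle a x ≤ Real.arcsin σ := by
  have ha' : 0 < ‖a‖ := norm_pos_iff.2 ha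
  have hx' : 0 < ‖x‖ := norm_pos_iff.2 hx
  have hc' : 0 < c := by
    refine hc.lt_of_ne' fun hc0 => ha ?_
    simpa [hc0] using h
  have hr : √(1 - σ ^ 2) ^ 2 = 1 - σ ^ 2 := Real.sq_sqrt (by nlinarith)
  have hexpand : ‖a‖ ^ 2 - 2 * (c * ⟪a, x⟫_ℝ) + (c * ‖x‖) ^ 2 ≤ (σ * (c * ‖x‖)) ^ 2 := by
    refine le_of_eq_of_le ?_ (pow_le_pow_left₀ (norm_nonneg _) h 2)
    rw [norm_sub_sq_real, real_inner_smul_right, norm_smul, Real.norm_of_nonneg hc]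
  have hinner : √(1 - σ ^ 2) * (‖a‖ * ‖x‖) ≤ ⟪a, x⟫_ℝ := by
    refine le_of_mul_le_mul_left ?_ hc'
    nlinarith [sq_nonneg (‖a‖ - √(1 - σ ^ 2) * (c * ‖x‖))]
  rw [Real.arcsin_eq_arccos hσ₀]
  exact Real.arccos_le_arccos ((le_div_iff₀ (mul_pos ha' hx')).2 hinner)

theorem inner_nonneg_of_norm_sub_smul_le {a b x : F} {c d σ τ : ℝ} (hc : 0 ≤ c) (hd : 0 ≤ d)
    (hσ : 0 ≤ σ) (hτ : 0 ≤ τ) (hστ : σ ^ 2 + τ ^ 2 ≤ 1) (ha : ‖a - c • x‖ ≤ σ * (c * ‖x‖))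
    (hb : ‖b - d • x‖ ≤ τ * (d * ‖x‖)) : 0 ≤ ⟪a, b⟫_ℝ := by
  rcases eq_or_ne x 0 with rfl | hx
  · have : a = 0 := by simpa using ha
    simp [this]
  rcases eq_or_ne a 0 with rfl | ha₀
  · simp
  rcases eq_or_ne b 0 with rfl | hb₀
  · simp
  have hax := angle_le_arcsin_of_norm_sub_smul_le ha₀ hx hc hσ (by nlinarith) ha
  have hbx := angle_le_arcsin_of_norm_sub_smul_le hb₀ hx hd hτ (by nlinarith) hb
  have hsum : Real.arcsin σ + Real.arcsin τ ≤ Real.pi / 2 := by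
    have : Real.arcsin τ ≤ Real.arccos σ := by
      rw [Real.arccos_eq_arcsin hσ]
      exact Real.arcsin_le_arcsin (Real.le_sqrt_of_sq_le (by linarith))
    rw [Real.arccos_eq_pi_div_two_sub_arcsin] at this
    linarith
  have hab : InnerProductGeometry.angle a b ≤ Real.pi / 2 := by
    have := InnerProductGeometry.angle_le_angle_add_angle a x b
    rw [InnerProductGeometry.angle_comm x b] at this
    linarith
  rw [← InnerProductGeometry.cos_angle_mul_norm_mul_norm]
  have hcos := Real.cos_nonneg_of_neg_pi_div_two_le_of_le
    (by linarith [InnerProductGeometry.angle_nonneg a b, Real.pi_pos]) hab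
  positivity

theorem norm_add_inner_smul_sub_smul (g : ℝ) {w : F} (hw : ‖w‖ = 1) (x : F) :
    ‖x + (g * ⟪w, x⟫_ℝ) • w - (1 + g / 2) • x‖ = |g| / 2 * ‖x‖ := by
  have hreflect : x + (g * ⟪w, x⟫_ℝ) • w - (1 + g / 2) • x
      = (g / 2) • ((2 * ⟪w, x⟫_ℝ) • w - x) := by module
  have hnorm : ‖(2 * ⟪w, x⟫_ℝ) • w - x‖ = ‖x‖ := by
    rw [← sq_eq_sq₀ (norm_nonneg _) (norm_nonneg _), norm_sub_sq_real, real_inner_smul_left,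
      norm_smul, hw, mul_one, Real.norm_eq_abs, sq_abs]
    ring
  rw [hreflect, norm_smul, hnorm, Real.norm_eq_abs, abs_div, abs_two]

variable {T : F →ₗ[ℝ] F} {p q : ℝ}

theorem exists_norm_eq_one_of_hasEigenvalue {μ : ℝ} (h : Module.End.HasEigenvalue T μ) :
    ∃ v : F, ‖v‖ = 1 ∧ T v = μ • v := by
  obtain ⟨v, hv⟩ := h.exists_hasEigenvector
  exact ⟨‖v‖⁻¹ • v, norm_smul_inv_norm hv.2, by rw [map_smul, hv.apply_eq_smul, smul_comm]⟩

theorem norm_apply_sub_midpoint_smul_le [FiniteDimensional ℝ F] (hT : T.IsSymmetric) (hpq : p ≤ q)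
    (hspec : ∀ μ, Module.End.HasEigenvalue T μ → μ ∈ Icc p q) (x : F) :
    ‖T x - ((p + q) / 2) • x‖ ≤ (q - p) / 2 * ‖x‖ := by
  set e := hT.eigenvectorBasis rfl with he
  rw [← sq_le_sq₀ (norm_nonneg _) (by have := norm_nonneg x; nlinarith), mul_pow,
    ← e.sum_sq_norm_inner_right, ← e.sum_sq_norm_inner_right x, Finset.mul_sum]
  refine Finset.sum_le_sum fun i _ => ?_
  have hmem : hT.eigenvalues rfl i ∈ Icc p q := hspec _ (hT.hasEigenvalue_eigenvalues rfl i)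
  have hcoord : ⟪e i, T x - ((p + q) / 2) • x⟫_ℝ
      = (hT.eigenvalues rfl i - (p + q) / 2) * ⟪e i, x⟫_ℝ := by
    rw [inner_sub_right, real_inner_smul_right, ← hT, hT.apply_eigenvectorBasis rfl,
      real_inner_smul_left]
    simp only [he, RCLike.ofReal_real_eq_id, id]
    ring
  rw [hcoord, norm_mul, mul_pow]
  refine mul_le_mul_of_nonneg_right ?_ (sq_nonneg _)
  rw [Real.norm_eq_abs, sq_abs, sq_le_sq, abs_of_nonneg (by linarith : 0 ≤ (q - p) / 2), abs_le]
  constructor <;> linarith [hmem.1, hmem.2]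

theorem inner_add_smul_apply_nonneg [FiniteDimensional ℝ F] (hT : T.IsSymmetric) (hpq : p ≤ q)
    (hspec : ∀ μ, Module.End.HasEigenvalue T μ → μ ∈ Icc p q) {g σ τ : ℝ} (hg : -2 ≤ g)
    (hsum : 0 ≤ p + q) (hσ : 0 ≤ σ) (hτ : 0 ≤ τ) (hστ : σ ^ 2 + τ ^ 2 ≤ 1)
    (hgσ : |g| ≤ σ * (g + 2)) (hpqτ : q - p ≤ τ * (p + q)) {w : F} (hw : ‖w‖ = 1) (x : F) :
    0 ≤ ⟪x + (g * ⟪w, x⟫_ℝ) • w, T x⟫_ℝ := by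
  have hx := norm_nonneg x
  refine inner_nonneg_of_norm_sub_smul_le (c := 1 + g / 2) (d := (p + q) / 2) (x := x)
    (by linarith) (by linarith) hσ hτ hστ ?_ ?_
  · rw [norm_add_inner_smul_sub_smul g hw]
    nlinarith
  · refine (norm_apply_sub_midpoint_smul_le hT hpq hspec x).trans ?_
    nlinarith

theorem sq_mul_add_sq_le_of_hasEigenvalue (hT : T.IsSymmetric)
    (hp : Module.End.HasEigenvalue T p) (hq : Module.End.HasEigenvalue T q) {g : ℝ} (hg : -1 ≤ g)
    (h : ∀ w : F, ‖w‖ = 1 → ∀ x, 0 ≤ ⟪x + (g * ⟪w, x⟫_ℝ) • w, T x⟫_ℝ) :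
    g ^ 2 * (p + q) ^ 2 ≤ 4 * (p * q) * (g + 2) ^ 2 := by
  rcases eq_or_ne p q with rfl | hpq
  · nlinarith [mul_nonneg (sq_nonneg p) (by linarith : 0 ≤ g + 1)]
  obtain ⟨v, hv, hTv⟩ := exists_norm_eq_one_of_hasEigenvalue hp
  obtain ⟨u, hu, hTu⟩ := exists_norm_eq_one_of_hasEigenvalue hq
  have hvu : ⟪v, u⟫_ℝ = 0 := by
    have := hT v u
    rw [hTv, hTu, real_inner_smul_left, real_inner_smul_right] at this
    exact (mul_eq_zero.1 (by linear_combination this : (p - q) * ⟪v, u⟫_ℝ = 0)).resolve_left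
      (sub_ne_zero.2 hpq)
  have hvv : ⟪v, v⟫_ℝ = 1 := by rw [real_inner_self_eq_norm_sq, hv, one_pow]
  have huu : ⟪u, u⟫_ℝ = 1 := by rw [real_inner_self_eq_norm_sq, hu, one_pow]
  have hw : ‖(√2)⁻¹ • (v + u)‖ = 1 := by
    have hsq : ‖v + u‖ ^ 2 = 2 := by
      rw [norm_add_sq_real, hv, hu, hvu]; norm_num
    rw [norm_smul, norm_inv, Real.norm_of_nonneg (Real.sqrt_nonneg 2), ← hsq,
      Real.sqrt_sq (norm_nonneg _), inv_mul_cancel₀]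
    exact fun h0 => by simp [h0] at hsq
  have hquad (t : ℝ) : 0 ≤ p * (g + 2) * (t * t) + g * (p + q) * t + q * (g + 2) := by
    have hsqrt : (√2)⁻¹ * (√2)⁻¹ = (2 : ℝ)⁻¹ := by
      rw [← mul_inv, Real.mul_self_sqrt zero_le_two]
    have ht := h _ hw (t • v + u)
    simp only [map_add, map_smul, hTv, hTu, inner_add_left, inner_add_right, real_inner_smul_left,
      real_inner_smul_right, hvv, huu, hvu, real_inner_comm v u] at ht
    linear_combination 2 * ht + g * (t + 1) * (t * p + q) * 2 * hsqrt
  have := discrim_le_zero hquad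
  rw [discrim] at this
  linarith

end Angles

section RadialMap

variable {F : Type*} [NormedAddCommGroup F] [InnerProductSpace ℝ F] {φ : ℝ → ℝ}

/-- The radial vector field `y ↦ φ(|y|) y`, so that `φ(|u|) u` is `radialMap φ ∘ u`. Its value at
`0` is `0` whatever `φ 0` is. -/
def radialMap (φ : ℝ → ℝ) (y : F) : F :=
  φ ‖y‖ • y

theorem fderiv_radialMap_smul {s : ℝ} (hs : 0 < s) (hφ : DifferentiableAt ℝ φ s) {w : F}
    (hw : ‖w‖ = 1) (v : F) :
    fderiv ℝ (radialMap φ) (s • w) v = φ s • v + (s * deriv φ s * ⟪w, v⟫_ℝ) • w := by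
  have hsw : ‖s • w‖ = s := by rw [norm_smul, hw, mul_one, Real.norm_of_nonneg hs.le]
  have hnorm : HasFDerivAt (fun y : F => ‖y‖) (innerSL ℝ w) (s • w) := by
    have := (hasStrictFDerivAt_norm_sq (s • w)).hasFDerivAt.sqrt (by simp [hsw, hs.ne'])
    simp only [Real.sqrt_sq (norm_nonneg _), hsw] at this
    convert this using 1
    ext v
    simp only [Real.sqrt_sq hs.le, map_smul, smul_apply, innerSL_apply_apply,
      smul_eq_mul, nsmul_eq_mul, Nat.cast_ofNat]
    field_simp
  have hφ' : HasDerivAt φ (deriv φ s) ‖s • w‖ := hsw.symm ▸ hφ.hasDerivAt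
  have hradial : HasFDerivAt (radialMap φ) _ (s • w) :=
    (hφ'.comp_hasFDerivAt _ hnorm).smul (hasFDerivAt_id (s • w))
  simp [hradial.fderiv, hsw, smul_smul, mul_comm, mul_assoc]

end RadialMap

section Weight

theorem contDiff_comp_sq {σ d : ℝ → ℝ} {C : ℝ} (hσ : ∀ t, 0 ≤ t → |σ t| ≤ C * t)
    (hσ' : ∀ t, 0 < t → HasDerivAt σ (d t) t) (hd : ContinuousOn d (Ioi 0))
    (hdC : ∀ t, 0 < t → |d t| ≤ C) : ContDiff ℝ 1 fun x => σ (x ^ 2) := by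
  have hderiv (x : ℝ) : HasDerivAt (fun x => σ (x ^ 2)) (2 * x * d (x ^ 2)) x := by
    rcases eq_or_ne x 0 with rfl | hx
    · have hO : (fun x : ℝ => σ (x ^ 2)) =O[𝓝 0] fun x => ‖x - 0‖ ^ 2 :=
        .of_bound C (.of_forall fun x => by simpa using hσ _ (sq_nonneg x))
      simpa [hasDerivAt_iff_hasFDerivAt] using hO.hasFDerivAt one_lt_two
    · have := (hσ' (x ^ 2) (by positivity)).comp x (hasDerivAt_pow 2 x)
      simpa [mul_comm] using! this
  refine contDiff_one_iff_deriv.2 ⟨fun x => (hderiv x).differentiableAt, ?_⟩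
  rw [funext fun x => (hderiv x).deriv]
  refine continuous_iff_continuousAt.2 fun x => ?_
  rcases eq_or_ne x 0 with rfl | hx
  · refine continuousAt_of_locally_lipschitz one_pos (2 * C) fun x _ => ?_
    rcases eq_or_ne x 0 with rfl | hx
    · simp
    · simpa [mul_right_comm] using
        mul_le_mul_of_nonneg_left (hdC (x ^ 2) (by positivity)) (abs_nonneg (2 * x))
  · have hdx := hd.continuousAt (Ioi_mem_nhds (by positivity : 0 < x ^ 2))
    exact (by fun_prop : ContinuousAt (fun x : ℝ => 2 * x) x).mul
      (hdx.comp (f := fun x => x ^ 2) (by fun_prop))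

variable {φ : ℝ → ℝ}

/-- Conditions (i)–(iii): `s ↦ s φ(s)` is an increasing `C¹` bijection of `(0, ∞)` onto itself. -/
structure IsRegularWeight (φ : ℝ → ℝ) : Prop where
  contDiffOn : ContDiffOn ℝ 1 φ (Ioi 0)
  deriv_pos : ∀ s, 0 < s → 0 < deriv (fun t => t * φ t) s
  range_eq : (fun s => s * φ s) '' Ioi 0 = Ioi 0

theorem IsAdmissible.isRegularWeight (h : IsAdmissible φ) : IsRegularWeight φ :=
  ⟨h.contDiffOn, h.deriv_pos, h.range_eq⟩

namespace IsRegularWeight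

section Calculus

variable (h : IsRegularWeight φ) {s : ℝ} (hs : 0 < s)
include h hs

theorem pos : 0 < φ s := by
  have : s * φ s ∈ Ioi (0 : ℝ) := h.range_eq ▸ mem_image_of_mem (fun t => t * φ t) hs
  exact pos_of_mul_pos_right this hs.le

theorem contDiffAt : ContDiffAt ℝ 1 φ s :=
  h.contDiffOn.contDiffAt (Ioi_mem_nhds hs)

theorem differentiableAt : DifferentiableAt ℝ φ s :=
  (h.contDiffAt hs).differentiableAt one_ne_zero

theorem hasDerivAt_id_mul : HasDerivAt (fun t => t * φ t) (φ s + s * deriv φ s) s := by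
  simpa using! (hasDerivAt_id s).mul (h.differentiableAt hs).hasDerivAt

theorem add_mul_deriv_pos : 0 < φ s + s * deriv φ s := by
  rw [← (h.hasDerivAt_id_mul hs).deriv]
  exact h.deriv_pos s hs

theorem continuousAt_deriv_id_mul : ContinuousAt (deriv fun t => t * φ t) s :=
  ((contDiffOn_id.mul h.contDiffOn).continuousOn_deriv_of_isOpen isOpen_Ioi le_rfl).continuousAt
    (Ioi_mem_nhds hs)

theorem fderiv_radialMap_smul {F : Type*} [NormedAddCommGroup F] [InnerProductSpace ℝ F] {w : F}
    (hw : ‖w‖ = 1) (v : F) :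
    fderiv ℝ (radialMap φ) (s • w) v = φ s • (v + (s * deriv φ s / φ s * ⟪w, v⟫_ℝ) • w) := by
  rw [FunctionalDissipativity.fderiv_radialMap_smul hs (h.differentiableAt hs) hw, smul_add,
    smul_smul, ← mul_assoc, mul_div_cancel₀ _ (h.pos hs).ne']

theorem neg_one_lt_elasticity : -1 < s * deriv φ s / φ s := by
  rw [lt_div_iff₀ (h.pos hs)]
  linarith [h.add_mul_deriv_pos hs]

theorem lambdaRatio_eq_elasticity :
    lambdaRatio φ s = -(s * deriv φ s / φ s / (s * deriv φ s / φ s + 2)) := by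
  have := (h.pos hs).ne'
  rw [lambdaRatio, div_add' _ _ _ this, div_div_div_cancel_right₀ this]

theorem lambdaRatio_sq_lt_one : lambdaRatio φ s ^ 2 < 1 := by
  have hg := h.neg_one_lt_elasticity hs
  rw [h.lambdaRatio_eq_elasticity hs, neg_sq, div_pow, div_lt_one (by nlinarith)]
  nlinarith

end Calculus

theorem contDiffAt_radialMap {F : Type*} [NormedAddCommGroup F] [InnerProductSpace ℝ F]
    (h : IsRegularWeight φ) {y : F} (hy : y ≠ 0) : ContDiffAt ℝ 1 (radialMap φ) y :=
  ((h.contDiffAt (norm_pos_iff.2 hy)).comp y (contDiffAt_norm ℝ hy)).smul contDiffAt_id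

theorem continuousOn_id_mul (h : IsRegularWeight φ) : ContinuousOn (fun s => s * φ s) (Ioi 0) :=
  continuousOn_id.mul h.contDiffOn.continuousOn

theorem strictMonoOn_id_mul (h : IsRegularWeight φ) : StrictMonoOn (fun s => s * φ s) (Ioi 0) :=
  strictMonoOn_of_deriv_pos (convex_Ioi 0) h.continuousOn_id_mul fun s hs =>
    h.deriv_pos s (interior_subset hs)

theorem tendsto_id_mul_zero (h : IsRegularWeight φ) :
    Tendsto (fun s => s * φ s) (𝓝[>] 0) (𝓝 0) := by
  rw [Metric.tendsto_nhds]
  intro ε hε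
  obtain ⟨r, hr, rfl⟩ : ε ∈ (fun s => s * φ s) '' Ioi 0 := h.range_eq.symm ▸ hε
  filter_upwards [Ioo_mem_nhdsGT hr] with s hs
  rw [Real.dist_eq, sub_zero, abs_of_pos (mul_pos hs.1 (h.pos hs.1))]
  exact h.strictMonoOn_id_mul hs.1 hr hs.2

theorem exists_add_id_mul_eq (h : IsRegularWeight φ) {t : ℝ} (ht : 0 < t) :
    ∃ s, 0 < s ∧ s + s * φ s = t := by
  refine isPreconnected_Ioi.intermediate_value_Ioi (f := fun s => s + s * φ s) (l₁ := 𝓝[>] 0)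
    (l₂ := atTop) inf_le_right (le_principal_iff.2 (Ioi_mem_atTop 0))
    (continuousOn_id.add h.continuousOn_id_mul) ?_ ?_ ht
  · simpa using (tendsto_id.mono_left nhdsWithin_le_nhds).add h.tendsto_id_mul_zero
  · refine tendsto_atTop_mono' _ ?_ tendsto_id
    filter_upwards [Ioi_mem_atTop 0] with s hs
    exact le_add_of_nonneg_right (mul_pos hs (h.pos hs)).le

theorem exists_mul_sqrt_eq (h : IsRegularWeight φ) {t : ℝ} (ht : 0 < t) :
    ∃ s, 0 < s ∧ s * √(φ s) = t := by
  have hmul (s : ℝ) (hs : 0 < s) : (s * √(φ s)) ^ 2 = s * (s * φ s) := by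
    rw [mul_pow, Real.sq_sqrt (h.pos hs).le]; ring
  obtain ⟨s, hs, hst⟩ : t ^ 2 ∈ (fun s => s * (s * φ s)) '' Ioi 0 := by
    refine isPreconnected_Ioi.intermediate_value_Ioi (f := fun s => s * (s * φ s)) (l₁ := 𝓝[>] 0)
      (l₂ := atTop) inf_le_right (le_principal_iff.2 (Ioi_mem_atTop 0))
      (continuousOn_id.mul h.continuousOn_id_mul) ?_ ?_ (sq_pos_of_pos ht)
    · simpa using (tendsto_id.mono_left nhdsWithin_le_nhds).mul h.tendsto_id_mul_zero
    · refine tendsto_atTop_mono' _ ?_ (tendsto_id.atTop_mul_const (h.pos one_pos))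
      filter_upwards [Ici_mem_atTop 1] with s hs
      have hs' : (0 : ℝ) < s := one_pos.trans_le hs
      refine mul_le_mul_of_nonneg_left ?_ hs'.le
      simpa using h.strictMonoOn_id_mul.monotoneOn (mem_Ioi.2 one_pos) hs' hs
  refine ⟨s, hs, ?_⟩
  rw [← sq_eq_sq₀ (mul_nonneg (le_of_lt hs) (Real.sqrt_nonneg _)) ht.le, hmul s hs]
  exact hst

theorem injOn_mul_sqrt (h : IsRegularWeight φ) : InjOn (fun s => s * √(φ s)) (Ioi 0) := by
  refine StrictMonoOn.injOn fun s hs t ht hst => ?_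
  have hmul (s : ℝ) (hs : 0 < s) : s * √(φ s) = √(s * (s * φ s)) := by
    rw [← mul_assoc, Real.sqrt_mul (mul_self_nonneg s), Real.sqrt_mul_self hs.le]
  have hs₀ := mul_pos hs (h.pos hs)
  simp only [hmul s hs, hmul t ht]
  exact Real.sqrt_lt_sqrt (mul_pos hs hs₀).le
    (mul_lt_mul'' hst (h.strictMonoOn_id_mul hs ht hst) (le_of_lt hs) hs₀.le)

theorem LambdaInftySq_eq_iSup_lambdaRatio (h : IsRegularWeight φ) :
    LambdaInftySq φ = ⨆ s : Ioi (0 : ℝ), lambdaRatio φ s ^ 2 := by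
  let f : Ioi (0 : ℝ) → Ioi (0 : ℝ) := fun s =>
    ⟨s * √(φ s), mul_pos s.2 (Real.sqrt_pos.2 (h.pos s.2))⟩
  have hf : Function.Surjective f := fun ⟨t, ht⟩ =>
    let ⟨s, hs, hst⟩ := h.exists_mul_sqrt_eq ht
    ⟨⟨s, hs⟩, Subtype.ext hst⟩
  refine (hf.iSup_congr f fun s => ?_).symm
  rw [Lambda, h.injOn_mul_sqrt.leftInvOn_invFunOn s.2]

theorem lambdaRatio_sq_le_LambdaInftySq (h : IsRegularWeight φ) {s : ℝ} (hs : 0 < s) :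
    lambdaRatio φ s ^ 2 ≤ LambdaInftySq φ := by
  rw [h.LambdaInftySq_eq_iSup_lambdaRatio]
  refine le_ciSup (f := fun s : Ioi (0 : ℝ) => lambdaRatio φ s ^ 2) ⟨1, ?_⟩ ⟨s, hs⟩
  rintro _ ⟨t, rfl⟩
  exact (h.lambdaRatio_sq_lt_one t.2).le

theorem LambdaInftySq_mul_le (h : IsRegularWeight φ) {c d : ℝ} (hc : 0 ≤ c)
    (hd : ∀ s, 0 < s → lambdaRatio φ s ^ 2 * c ≤ d) : LambdaInftySq φ * c ≤ d := by
  have : Nonempty (Ioi (0 : ℝ)) := ⟨⟨1, mem_Ioi.2 one_pos⟩⟩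
  rw [h.LambdaInftySq_eq_iSup_lambdaRatio, Real.iSup_mul_of_nonneg hc]
  exact ciSup_le fun s => hd s s.2

theorem LambdaInftySq_le_one (h : IsRegularWeight φ) : LambdaInftySq φ ≤ 1 := by
  simpa using h.LambdaInftySq_mul_le zero_le_one fun s hs => by
    simpa only [mul_one] using (h.lambdaRatio_sq_lt_one hs).le

theorem abs_sub_le_abs_add_id_mul_sub (h : IsRegularWeight φ) {s t : ℝ} (hs : 0 < s)
    (ht : 0 < t) : |s - t| ≤ |s + s * φ s - (t + t * φ t)| := by
  rcases le_total s t with hst | hst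
  · have := h.strictMonoOn_id_mul.monotoneOn hs ht hst
    rw [abs_of_nonpos (by linarith), abs_of_nonpos (by linarith)]
    linarith
  · have := h.strictMonoOn_id_mul.monotoneOn ht hs hst
    rw [abs_of_nonneg (by linarith), abs_of_nonneg (by linarith)]
    linarith

theorem injOn_add_id_mul (h : IsRegularWeight φ) : InjOn (fun s => s + s * φ s) (Ici 0) := by
  refine StrictMonoOn.injOn fun s hs t _ hst => ?_
  have ht : 0 < t := lt_of_le_of_lt hs hst
  rcases (mem_Ici.1 hs).eq_or_lt with rfl | hs
  · simpa using add_pos ht (mul_pos ht (h.pos ht))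
  · exact add_lt_add hst (h.strictMonoOn_id_mul hs ht hst)

theorem exists_hasDerivAt_resolvent (h : IsRegularWeight φ) :
    ∃ σ : ℝ → ℝ, σ 0 = 0 ∧ (∀ t, 0 ≤ t → σ t + σ t * φ (σ t) = t) ∧ ∀ t, 0 < t →
      0 < σ t ∧ HasDerivAt σ (1 + deriv (fun s => s * φ s) (σ t))⁻¹ t := by
  have hex (t : ℝ) : ∃ s, (0 < t → 0 < s ∧ s + s * φ s = t) ∧ (t = 0 → s = 0) := by
    rcases lt_or_ge 0 t with ht | ht
    · obtain ⟨s, hs, hst⟩ := h.exists_add_id_mul_eq ht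
      exact ⟨s, fun _ => ⟨hs, hst⟩, fun h0 => absurd h0 ht.ne'⟩
    · exact ⟨0, fun h0 => absurd h0 ht.not_gt, fun _ => rfl⟩
  choose σ hσ hσ₀ using hex
  have hcont {t : ℝ} (ht : 0 < t) : ContinuousAt σ t := by
    refine LipschitzOnWith.continuousOn (K := 1) (s := Ioi 0)
      (LipschitzOnWith.of_dist_le_mul fun a ha b hb => ?_) |>.continuousAt (Ioi_mem_nhds ht)
    have := h.abs_sub_le_abs_add_id_mul_sub (hσ a ha).1 (hσ b hb).1
    rwa [(hσ a ha).2, (hσ b hb).2, ← one_mul |a - b|] at this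
  refine ⟨σ, hσ₀ 0 rfl, fun t ht => ?_, fun t ht => ⟨(hσ t ht).1, ?_⟩⟩
  · rcases ht.eq_or_lt with rfl | ht
    · rw [hσ₀ 0 rfl, zero_mul, add_zero]
    · exact (hσ t ht).2
  · have hF := (hasDerivAt_id (σ t)).add (h.hasDerivAt_id_mul (hσ t ht).1)
    rw [← (h.hasDerivAt_id_mul (hσ t ht).1).deriv] at hF
    refine hF.of_local_left_inverse (hcont ht) ?_ ?_
    · linarith [h.deriv_pos _ (hσ t ht).1]
    · filter_upwards [Ioi_mem_nhds ht] with r hr using (hσ r hr).2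

/-- The reparametrisation behind the test functions: the resolvent `(id + s φ(s))⁻¹` applied to
`x²` splits `x²` into `g` and `g φ(g)`, both of which are `C¹` across the zero of `x`, however
singular `φ` is at `0`. -/
theorem exists_contDiff_add_mul_eq_sq (h : IsRegularWeight φ) :
    ∃ g : ℝ → ℝ, ContDiff ℝ 1 g ∧ (∀ x, 0 ≤ g x) ∧ ∀ x, g x + g x * φ (g x) = x ^ 2 := by
  obtain ⟨σ, hσ₀, hσ, hσ'⟩ := h.exists_hasDerivAt_resolvent
  have hnonneg (t : ℝ) (ht : 0 ≤ t) : 0 ≤ σ t := by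
    rcases ht.eq_or_lt with rfl | ht
    exacts [hσ₀.ge, (hσ' t ht).1.le]
  have hle (t : ℝ) (ht : 0 ≤ t) : σ t ≤ t := by
    rcases ht.eq_or_lt with rfl | ht
    · exact hσ₀.le
    · have := (hσ' t ht).1
      linarith [hσ t ht.le, mul_pos this (h.pos this)]
  have hderiv_pos (t : ℝ) (ht : 0 < t) := h.deriv_pos _ (hσ' t ht).1
  refine ⟨fun x => σ (x ^ 2), contDiff_comp_sq (C := 1)
    (d := fun t => (1 + deriv (fun s => s * φ s) (σ t))⁻¹) (fun t ht => ?_)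
    (fun t ht => (hσ' t ht).2) (fun t ht => ?_) (fun t ht => ?_),
    fun x => hnonneg _ (sq_nonneg x), fun x => hσ _ (sq_nonneg x)⟩
  · rw [one_mul, abs_of_nonneg (hnonneg t ht)]
    exact hle t ht
  · refine (ContinuousAt.inv₀ (continuousAt_const.add ?_) ?_).continuousWithinAt
    · exact (h.continuousAt_deriv_id_mul (hσ' t ht).1).comp (hσ' t ht).2.continuousAt
    · exact (add_pos one_pos (hderiv_pos t ht)).ne'
  · rw [abs_of_pos (inv_pos.2 (by linarith [hderiv_pos t ht]))]
    exact inv_le_one_of_one_le₀ (by linarith [hderiv_pos t ht])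

end IsRegularWeight

end Weight

section Accretivity

variable {F : Type*} [NormedAddCommGroup F] [InnerProductSpace ℝ F] {φ : ℝ → ℝ}

/-- The pointwise form of dissipativity: wherever `u = y ≠ 0`, the chain rule turns
`Re ⟨𝓑 u', (φ(|u|) u)'⟩` into `⟪D(radialMap φ)(y) u', 𝓑 u'⟫`, and this is required to be nonnegative
for all values of `y` and `u'`. -/
def IsRadiallyAccretive (φ : ℝ → ℝ) (T : F → F) : Prop :=
  ∀ y, y ≠ 0 → ∀ v, 0 ≤ ⟪fderiv ℝ (radialMap φ) y v, T v⟫_ℝ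

theorem IsRegularWeight.isRadiallyAccretive_iff_elasticity (h : IsRegularWeight φ) {T : F → F} :
    IsRadiallyAccretive φ T ↔ ∀ s, 0 < s → ∀ w : F, ‖w‖ = 1 → ∀ v,
      0 ≤ ⟪v + (s * deriv φ s / φ s * ⟪w, v⟫_ℝ) • w, T v⟫_ℝ := by
  have hpolar {s : ℝ} (hs : 0 < s) {w : F} (hw : ‖w‖ = 1) (v : F) :
      0 ≤ ⟪fderiv ℝ (radialMap φ) (s • w) v, T v⟫_ℝ ↔
        0 ≤ ⟪v + (s * deriv φ s / φ s * ⟪w, v⟫_ℝ) • w, T v⟫_ℝ := by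
    rw [h.fderiv_radialMap_smul hs hw, real_inner_smul_left, mul_nonneg_iff_of_pos_left (h.pos hs)]
  constructor
  · intro hT s hs w hw v
    have hw₀ : w ≠ 0 := norm_ne_zero_iff.1 (hw.trans_ne one_ne_zero)
    exact (hpolar hs hw v).1 (hT _ (smul_ne_zero hs.ne' hw₀) v)
  · intro hT y hy v
    have hy' := norm_pos_iff.2 hy
    have := (hpolar hy' (norm_smul_inv_norm (𝕜 := ℝ) hy) v).2
      (hT _ hy' _ (norm_smul_inv_norm (𝕜 := ℝ) hy) v)
    rwa [RCLike.ofReal_real_eq_id, id, smul_inv_smul₀ hy'.ne'] at this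

variable {T : F →ₗ[ℝ] F} {p q : ℝ}

theorem IsRadiallyAccretive.sub_le_sqrt_mul_add (hacc : IsRadiallyAccretive φ T)
    (h : IsRegularWeight φ) (hT : T.IsSymmetric)
    (hp : Module.End.HasEigenvalue T p) (hq : Module.End.HasEigenvalue T q) :
    q - p ≤ √(1 - LambdaInftySq φ) * (p + q) := by
  rw [h.isRadiallyAccretive_iff_elasticity] at hacc
  have hprod : LambdaInftySq φ * (p + q) ^ 2 ≤ 4 * (p * q) := by
    refine h.LambdaInftySq_mul_le (sq_nonneg _) fun s hs => ?_
    have hg := h.neg_one_lt_elasticity hs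
    have := sq_mul_add_sq_le_of_hasEigenvalue hT hp hq hg.le (hacc s hs)
    rwa [h.lambdaRatio_eq_elasticity hs, neg_sq, div_pow, div_mul_eq_mul_div,
      div_le_iff₀ (by nlinarith)]
  have hnonneg {μ : ℝ} (hμ : Module.End.HasEigenvalue T μ) : 0 ≤ μ := by
    obtain ⟨v, hv, hTv⟩ := exists_norm_eq_one_of_hasEigenvalue hμ
    have hv' := hacc 1 one_pos v hv v
    rw [real_inner_self_eq_norm_sq, hv, hTv, real_inner_smul_right, inner_add_left,
      real_inner_smul_left, real_inner_self_eq_norm_sq, hv] at hv'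
    nlinarith [h.neg_one_lt_elasticity one_pos]
  have hτ := Real.sq_sqrt (sub_nonneg.2 h.LambdaInftySq_le_one)
  exact le_of_sq_le_sq (by nlinarith)
    (mul_nonneg (Real.sqrt_nonneg _) (add_nonneg (hnonneg hp) (hnonneg hq)))

theorem isRadiallyAccretive_of_sub_le_sqrt_mul_add [FiniteDimensional ℝ F]
    (h : IsRegularWeight φ) (hΛ : LambdaInftySq φ < 1) (hT : T.IsSymmetric) (hpq : p ≤ q)
    (hspec : ∀ μ, Module.End.HasEigenvalue T μ → μ ∈ Icc p q)
    (hle : q - p ≤ √(1 - LambdaInftySq φ) * (p + q)) : IsRadiallyAccretive φ T := by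
  refine h.isRadiallyAccretive_iff_elasticity.2 fun s hs w hw v => ?_
  have hL₀ := (sq_nonneg _).trans (h.lambdaRatio_sq_le_LambdaInftySq hs)
  have hτ₀ : 0 < √(1 - LambdaInftySq φ) := Real.sqrt_pos.2 (by linarith)
  have hg₂ : 0 < s * deriv φ s / φ s + 2 := by linarith [h.neg_one_lt_elasticity hs]
  have hgσ := Real.abs_le_sqrt (h.lambdaRatio_sq_le_LambdaInftySq hs)
  rw [h.lambdaRatio_eq_elasticity hs, abs_neg, abs_div, abs_of_pos hg₂, div_le_iff₀ hg₂] at hgσ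
  refine inner_add_smul_apply_nonneg hT hpq hspec (by linarith) (by nlinarith)
    (Real.sqrt_nonneg _) hτ₀.le ?_ hgσ hle hw v
  rw [Real.sq_sqrt hL₀, Real.sq_sqrt (by linarith)]
  linarith

theorem isRadiallyAccretive_iff [FiniteDimensional ℝ F] (h : IsRegularWeight φ)
    (hΛ : LambdaInftySq φ < 1) (hT : T.IsSymmetric)
    (hp : IsLeast {μ | Module.End.HasEigenvalue T μ} p)
    (hq : IsGreatest {μ | Module.End.HasEigenvalue T μ} q) :
    IsRadiallyAccretive φ T ↔
      0 ≤ (1 + √(1 - LambdaInftySq φ)) * p - (1 - √(1 - LambdaInftySq φ)) * q := by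
  constructor <;> intro H
  · linarith [H.sub_le_sqrt_mul_add h hT hp.1 hq.1]
  · exact isRadiallyAccretive_of_sub_le_sqrt_mul_add h hΛ hT (hp.2 hq.1)
      (fun μ hμ => ⟨hp.2 hμ, hq.2 hμ⟩) (by linarith)

end Accretivity

section Integrability

variable {𝕜 F : Type*} [RCLike 𝕜] [NormedAddCommGroup F] [NormedSpace 𝕜 F] {K : Set ℝ}

theorem integrableOn_clm_apply {T : ℝ → F →L[𝕜] F} {q : ℝ → F} (hK : IsCompact K)
    (hT : IntegrableOn T K) (hq : Continuous q) : IntegrableOn (fun x => T x (q x)) K := by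
  obtain ⟨C, hC⟩ := hK.exists_bound_of_continuousOn hq.continuousOn
  refine (ContinuousLinearMap.id 𝕜 (F →L[𝕜] F)).integrable_of_bilin_of_bdd_right C hT
    (hq.continuousOn.aestronglyMeasurable_of_isCompact hK hK.measurableSet) ?_
  exact ae_restrict_of_forall_mem hK.measurableSet hC

theorem integrableOn_inner {𝕜 F : Type*} [RCLike 𝕜] [NormedAddCommGroup F]
    [InnerProductSpace 𝕜 F] {p q : ℝ → F} (hK : IsCompact K) (hp : Continuous p)
    (hq : IntegrableOn q K) : IntegrableOn (fun x => inner 𝕜 (p x) (q x)) K := by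
  obtain ⟨C, hC⟩ := hK.exists_bound_of_continuousOn hp.continuousOn
  refine (hq.norm.const_mul C).mono'
    ((hp.continuousOn.aestronglyMeasurable_of_isCompact hK hK.measurableSet).inner
      hq.aestronglyMeasurable) ?_
  filter_upwards [ae_restrict_mem hK.measurableSet] with x hx
  exact (norm_inner_le_norm _ _).trans (mul_le_mul_of_nonneg_right (hC x hx) (norm_nonneg _))

end Integrability

section LebesguePoints

variable {E : Type*} [NormedAddCommGroup E] {f g : ℝ → E} {x : ℝ}

/-- `x` is a Lebesgue point of `f`: the mean deviation of `f` from `f x` over `[x - ε, x + ε]`, here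
rescaled to `[-1, 1]`, tends to `0` with `ε`. -/
def IsLebesguePoint (f : ℝ → E) (x : ℝ) : Prop :=
  Tendsto (fun ε => ∫ z in (-1)..1, ‖f (x + ε * z) - f x‖) (𝓝[>] 0) (𝓝 0)

theorem ae_isLebesguePoint_of_locallyIntegrable (hf : LocallyIntegrable f) :
    ∀ᵐ x, IsLebesguePoint f x := by
  filter_upwards [IsUnifLocDoublingMeasure.ae_tendsto_average_norm_sub volume hf 1] with x hx
  have hmean := (hx (fun _ : ℝ => x) (fun ε => ε) (l := 𝓝[>] 0) tendsto_id (by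
    filter_upwards [self_mem_nhdsWithin] with ε hε
    exact Metric.mem_closedBall_self (by simpa using le_of_lt hε))).const_mul 2
  rw [mul_zero] at hmean
  refine hmean.congr' ?_
  filter_upwards [self_mem_nhdsWithin] with ε (hε : 0 < ε)
  rw [intervalIntegral.integral_comp_add_mul (fun y => ‖f y - f x‖) hε.ne' x, setAverage_eq,
    Real.closedBall_eq_Icc, integral_Icc_eq_integral_Ioc,
    ← intervalIntegral.integral_of_le (by linarith), Measure.real, Real.volume_Icc,
    ENNReal.toReal_ofReal (by linarith), mul_neg_one, mul_one, ← sub_eq_add_neg, smul_eq_mul,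
    smul_eq_mul, show x + ε - (x - ε) = 2 * ε by ring]
  field_simp

theorem IsLebesguePoint.congr_of_eventuallyEq (hf : IsLebesguePoint f x) (hfg : f =ᶠ[𝓝 x] g) :
    IsLebesguePoint g x := by
  refine hf.congr' ?_
  obtain ⟨r, hr, hfg'⟩ := Metric.eventually_nhds_iff.1 hfg
  filter_upwards [Ioo_mem_nhdsGT hr] with ε hε
  refine intervalIntegral.integral_congr fun z hz => ?_
  rw [uIcc_of_le (by norm_num)] at hz
  have hdist : dist (x + ε * z) x < r := by
    rw [dist_self_add_left, norm_mul, Real.norm_of_nonneg hε.1.le, Real.norm_eq_abs]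
    exact (mul_le_of_le_one_right hε.1.le (abs_le.2 hz)).trans_lt hε.2
  simp only [hfg' hdist, hfg.self_of_nhds]

theorem ae_isLebesguePoint {I : Set ℝ} (hI : IsOpen I) (hf : LocallyIntegrableOn f I) :
    ∀ᵐ x ∂volume.restrict I, IsLebesguePoint f x := by
  obtain ⟨U, hU, hIU, hfU⟩ := hf.exists_nat_integrableOn
  have hUI (n : ℕ) : IsOpen (U n ∩ I) := (hU n).inter hI
  have hae : ∀ᵐ x, ∀ n, IsLebesguePoint ((U n ∩ I).indicator f) x := ae_all_iff.2 fun n =>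
    ae_isLebesguePoint_of_locallyIntegrable
      ((hfU n).integrable_indicator (hUI n).measurableSet).locallyIntegrable
  rw [ae_restrict_iff' hI.measurableSet]
  filter_upwards [hae] with x hx hxI
  obtain ⟨n, hn⟩ := mem_iUnion.1 (hIU hxI)
  refine (hx n).congr_of_eventuallyEq ?_
  filter_upwards [(hUI n).mem_nhds ⟨hn, hxI⟩] with y hy using indicator_of_mem hy f

theorem eventually_intervalIntegrable_comp_add_mul (hf : IntegrableAtFilter f (𝓝 x)) :
    ∀ᶠ ε in 𝓝[>] (0 : ℝ), IntervalIntegrable (fun z => f (x + ε * z)) volume (-1) 1 := by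
  obtain ⟨s, hs, hfs⟩ := hf
  obtain ⟨r, hr, hrs⟩ := Metric.nhds_basis_closedBall.mem_iff.1 hs
  rw [Real.closedBall_eq_Icc] at hrs
  filter_upwards [Ioo_mem_nhdsGT hr] with ε hε
  have hint : IntervalIntegrable f volume (x + ε * -1) (x + ε * 1) :=
    ((hfs.mono_set hrs).mono_set (uIcc_subset_Icc ⟨by linarith [hε.2], by linarith [hε.1, hε.2]⟩
      ⟨by linarith [hε.1, hε.2], by linarith [hε.2]⟩)).intervalIntegrable
  simpa [hε.1.ne'] using (hint.comp_add_left x).comp_mul_left (c := ε)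

theorem IsLebesguePoint.tendsto_integral_inner {F ι : Type*} [NormedAddCommGroup F]
    [InnerProductSpace ℝ F] {f : ℝ → F} (hx : IsLebesguePoint f x)
    (hf : IntegrableAtFilter f (𝓝 x)) {l : Filter ι} [l.IsCountablyGenerated] {ε : ι → ℝ}
    (hε : Tendsto ε l (𝓝[>] 0)) {p : ι → ℝ → F} {p₀ : ℝ → F} {C : ℝ}
    (hp : ∀ᶠ i in l, Continuous (p i) ∧ ∀ z, ‖p i z‖ ≤ C)
    (hp₀ : ∀ z, Tendsto (fun i => p i z) l (𝓝 (p₀ z))) :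
    Tendsto (fun i => ∫ z in (-1)..1, ⟪p i z, f (x + ε i * z)⟫_ℝ) l
      (𝓝 (∫ z in (-1)..1, ⟪p₀ z, f x⟫_ℝ)) := by
  have hint := hε.eventually (eventually_intervalIntegrable_comp_add_mul hf)
  have hfrozen : Tendsto (fun i => ∫ z in (-1)..1, ⟪p i z, f x⟫_ℝ) l
      (𝓝 (∫ z in (-1)..1, ⟪p₀ z, f x⟫_ℝ)) := by
    refine intervalIntegral.tendsto_integral_filter_of_dominated_convergence
      (fun _ => C * ‖f x‖) ?_ ?_ intervalIntegrable_const
      (.of_forall fun z _ => (hp₀ z).inner tendsto_const_nhds)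
    · filter_upwards [hp] with i hi
      exact (hi.1.inner continuous_const).aestronglyMeasurable
    · filter_upwards [hp] with i hi
      exact .of_forall fun z _ => (norm_inner_le_norm _ _).trans
        (mul_le_mul_of_nonneg_right (hi.2 z) (norm_nonneg _))
  have hdev : Tendsto (fun i => ∫ z in (-1)..1, ⟪p i z, f (x + ε i * z) - f x⟫_ℝ) l (𝓝 0) := by
    refine squeeze_zero_norm' ?_ (by simpa using (hx.comp hε).const_mul C)
    filter_upwards [hp, hint] with i hi hfi
    rw [← intervalIntegral.integral_const_mul]
    refine intervalIntegral.norm_integral_le_of_norm_le (by norm_num) (.of_forall fun z _ => ?_)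
      ((hfi.sub intervalIntegrable_const).norm.const_mul C)
    exact (norm_inner_le_norm _ _).trans (mul_le_mul_of_nonneg_right (hi.2 z) (norm_nonneg _))
  rw [← add_zero (∫ z in (-1)..1, ⟪p₀ z, f x⟫_ℝ)]
  refine (hfrozen.add hdev).congr' ?_
  filter_upwards [hp, hint] with i hi hfi
  have hfi' := hfi.sub (intervalIntegrable_const (c := f x))
  rw [intervalIntegrable_iff_integrableOn_Icc_of_le (by norm_num)] at hfi'
  rw [← intervalIntegral.integral_add ((hi.1.inner continuous_const).intervalIntegrable _ _)
    ((intervalIntegrable_iff_integrableOn_Icc_of_le (by norm_num)).2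
      (integrableOn_inner isCompact_Icc hi.1 hfi'))]
  simp only [← inner_add_right, add_sub_cancel]

theorem IsLebesguePoint.clm_apply {𝕜 F : Type*} [RCLike 𝕜] [NormedAddCommGroup F]
    [NormedSpace 𝕜 F] {T : ℝ → F →L[𝕜] F} (hx : IsLebesguePoint T x)
    (hT : IntegrableAtFilter T (𝓝 x)) (v : F) : IsLebesguePoint (fun x => T x v) x := by
  refine squeeze_zero_norm' ?_ (by simpa using Tendsto.mul_const ‖v‖ hx)
  filter_upwards [eventually_intervalIntegrable_comp_add_mul hT] with ε hε
  rw [← intervalIntegral.integral_mul_const]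
  refine intervalIntegral.norm_integral_le_of_norm_le (by norm_num) (.of_forall fun z _ => ?_)
    ((hε.sub intervalIntegrable_const).norm.mul_const ‖v‖)
  rw [norm_norm, ← sub_apply]
  exact (T (x + ε * z) - T x).le_opNorm v

theorem ae_deriv_eq_zero_of_eq [NormedSpace ℝ E] (u : ℝ → E) (c : E) :
    ∀ᵐ x, u x = c → deriv u x = 0 := by
  refine ae_iff.2 (measure_null_of_locally_null _ fun x hx => ⟨{x}, ?_, measure_singleton x⟩)
  obtain ⟨-, hd⟩ := Classical.not_imp.1 hx
  have hne := (differentiableAt_of_deriv_ne_zero hd).hasDerivAt.eventually_ne (c := c) hd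
  rw [eventually_nhdsWithin_iff] at hne
  filter_upwards [mem_nhdsWithin_of_mem_nhds hne, self_mem_nhdsWithin] with z hz hzS
  by_contra hzx
  exact hz hzx (Classical.not_imp.1 hzS).1

end LebesguePoints

section Perturbation

variable {F : Type*} [NormedAddCommGroup F] [InnerProductSpace ℝ F] {φ : ℝ → ℝ} {u : ℝ → F}
  {θ : ℝ → ℝ} {N : Set ℝ} {y v : F}

theorem eventuallyEq_add_smul_of_notMem_tsupport {x : ℝ} (hx : x ∉ tsupport θ) :
    (fun z => u z + θ z • v) =ᶠ[𝓝 x] u := by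
  filter_upwards [notMem_tsupport_iff_eventuallyEq.1 hx] with z hz
  simp [hz]

theorem IsRegularWeight.contDiff_radialMap_add_smul (h : IsRegularWeight φ)
    (hw : ContDiff ℝ 1 (radialMap φ ∘ u)) (hN : IsOpen N) (huN : ∀ x ∈ N, u x = y)
    (hθ : ContDiff ℝ 1 θ) (hθN : tsupport θ ⊆ N) (hne : ∀ x, y + θ x • v ≠ 0) :
    ContDiff ℝ 1 (radialMap φ ∘ fun x => u x + θ x • v) := by
  refine contDiff_iff_contDiffAt.2 fun x => ?_
  by_cases hx : x ∈ N
  · have hθv : ContDiffAt ℝ 1 (fun x => y + θ x • v) x := by fun_prop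
    refine ((h.contDiffAt_radialMap (hne x)).comp x hθv).congr_of_eventuallyEq ?_
    filter_upwards [hN.mem_nhds hx] with z hz
    simp only [Function.comp_apply, huN z hz]
  · exact hw.contDiffAt.congr_of_eventuallyEq
      ((eventuallyEq_add_smul_of_notMem_tsupport (mt (@hθN x) hx)).fun_comp (radialMap φ))

theorem IsRegularWeight.inner_deriv_radialMap_add_smul (h : IsRegularWeight φ) (hN : IsOpen N)
    (huN : ∀ x ∈ N, u x = y) (hθ : Differentiable ℝ θ) (hθN : tsupport θ ⊆ N)
    (hne : ∀ x, y + θ x • v ≠ 0) (T : F →ₗ[ℝ] F) (x : ℝ) :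
    ⟪deriv (radialMap φ ∘ fun x => u x + θ x • v) x, T (deriv (fun x => u x + θ x • v) x)⟫_ℝ =
      ⟪deriv (radialMap φ ∘ u) x, T (deriv u x)⟫_ℝ +
        deriv θ x ^ 2 * ⟪fderiv ℝ (radialMap φ) (y + θ x • v) v, T v⟫_ℝ := by
  by_cases hx : x ∈ N
  · have hu : u =ᶠ[𝓝 x] fun _ => y := eventually_of_mem (hN.mem_nhds hx) huN
    have hderiv_u : deriv u x = 0 := by rw [hu.deriv_eq, deriv_const]
    have hU : HasDerivAt (fun x => u x + θ x • v) (deriv θ x • v) x :=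
      (((hθ x).hasDerivAt.smul_const v).const_add y).congr_of_eventuallyEq
        (hu.mono fun z hz => by simp only [hz])
    have hradial : HasFDerivAt (radialMap φ) (fderiv ℝ (radialMap φ) (y + θ x • v))
        (u x + θ x • v) := by
      rw [huN x hx]
      exact ((h.contDiffAt_radialMap (hne x)).differentiableAt one_ne_zero).hasFDerivAt
    rw [(hradial.comp_hasDerivAt x hU).deriv, hU.deriv, hderiv_u, map_zero, inner_zero_right,
      map_smul, map_smul, real_inner_smul_left, real_inner_smul_right]
    ring
  · have hx' : x ∉ tsupport θ := mt (@hθN x) hx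
    have hU := eventuallyEq_add_smul_of_notMem_tsupport (u := u) (v := v) hx'
    have hθx : deriv θ x = 0 :=
      image_eq_zero_of_notMem_tsupport (mt (@tsupport_deriv_subset ℝ _ _ _ _ θ x) hx')
    rw [hU.deriv_eq, (hU.fun_comp (radialMap φ)).deriv_eq, hθx]
    simp

end Perturbation

section Concentration

theorem exists_bump_profile : ∃ ψ : ℝ → ℝ, ContDiff ℝ 1 ψ ∧ (∀ z, |ψ z| ≤ 1) ∧
    tsupport ψ ⊆ Icc (-1) 1 ∧ 0 < ∫ z in (-1)..1, deriv ψ z ^ 2 := by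
  let ψ : ContDiffBump (0 : ℝ) := ⟨1 / 2, 1, by norm_num, by norm_num⟩
  have hψ : ContDiff ℝ 1 ψ := ψ.contDiff
  have hsupp : tsupport ψ ⊆ Icc (-1) 1 := by
    rw [ψ.tsupport_eq, Real.closedBall_eq_Icc]
    norm_num [ψ]
  refine ⟨ψ, hψ, fun z => ?_, hsupp, ?_⟩
  · rw [abs_of_nonneg ψ.nonneg]
    exact ψ.le_one
  obtain ⟨z, hz, hdz⟩ : ∃ z ∈ Ioo (0 : ℝ) 1, deriv ψ z = (ψ 1 - ψ 0) / (1 - 0) :=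
    exists_deriv_eq_slope ψ one_pos hψ.continuous.continuousOn
      (hψ.differentiable one_ne_zero).differentiableOn
  have hψ₀ : ψ 0 = 1 := ψ.one_of_mem_closedBall (Metric.mem_closedBall_self (by norm_num [ψ]))
  have hψ₁ : ψ 1 = 0 := ψ.zero_of_le_dist (by norm_num [ψ])
  rw [hψ₀, hψ₁] at hdz
  refine intervalIntegral.integral_pos (by norm_num)
    ((hψ.continuous_deriv le_rfl).pow 2).continuousOn (fun _ _ => sq_nonneg _)
    ⟨z, ⟨by linarith [hz.1], hz.2.le⟩, by norm_num [hdz]⟩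

variable {F : Type*} [NormedAddCommGroup F] [InnerProductSpace ℝ F] {f G : ℝ → F} {ψ : ℝ → ℝ}
  {x : ℝ}

theorem mul_integral_deriv_spike_sq_mul_inner {δ : ℝ} (hδ : 0 < δ)
    (hψ : tsupport ψ ⊆ Icc (-1) 1) :
    δ * ∫ z, deriv (fun z => δ * ψ ((δ ^ 3)⁻¹ * (z - x))) z ^ 2 *
        ⟪G (δ * ψ ((δ ^ 3)⁻¹ * (z - x))), f z⟫_ℝ =
      ∫ z in (-1)..1, ⟪deriv ψ z ^ 2 • G (δ * ψ z), f (x + δ ^ 3 * z)⟫_ℝ := by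
  set H : ℝ → ℝ := fun z => deriv (fun z => δ * ψ ((δ ^ 3)⁻¹ * (z - x))) z ^ 2 *
    ⟪G (δ * ψ ((δ ^ 3)⁻¹ * (z - x))), f z⟫_ℝ with hH
  have hδ' : δ ^ 3 ≠ 0 := (pow_pos hδ 3).ne'
  have hsubst : ∫ z, H z = δ ^ 3 * ∫ z, H (x + δ ^ 3 * z) := by
    rw [Measure.integral_comp_mul_left (fun z => H (x + z)), integral_add_left_eq_self,
      abs_of_pos (inv_pos.2 (pow_pos hδ 3)), smul_eq_mul, mul_inv_cancel_left₀ hδ']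
  have hHz (z : ℝ) : H (x + δ ^ 3 * z) =
      (δ ^ 4)⁻¹ * ⟪deriv ψ z ^ 2 • G (δ * ψ z), f (x + δ ^ 3 * z)⟫_ℝ := by
    have harg : (δ ^ 3)⁻¹ * (x + δ ^ 3 * z - x) = z := by field_simp; ring
    have hderiv : deriv (fun z => δ * ψ ((δ ^ 3)⁻¹ * (z - x))) (x + δ ^ 3 * z) =
        δ * ((δ ^ 3)⁻¹ * deriv ψ z) := by
      rw [deriv_const_mul_field, deriv_comp_sub_const (fun z => ψ ((δ ^ 3)⁻¹ * z)),
        deriv_comp_mul_left, harg, smul_eq_mul]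
    simp only [hH, hderiv, harg, real_inner_smul_left]
    field_simp
  rw [hsubst]
  simp only [hHz]
  rw [integral_const_mul, intervalIntegral.integral_of_le (by norm_num),
    ← integral_Icc_eq_integral_Ioc, setIntegral_eq_integral_of_forall_compl_eq_zero]
  · field_simp
  · intro z hz
    have hψz : deriv ψ z = 0 := image_eq_zero_of_notMem_tsupport
      (mt (@tsupport_deriv_subset ℝ _ _ _ _ ψ z) (mt (@hψ z) hz))
    simp [hψz]

theorem tsupport_spike_subset {δ : ℝ} (hδ : 0 < δ) (hψ : tsupport ψ ⊆ Icc (-1) 1) :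
    tsupport (fun z => δ * ψ ((δ ^ 3)⁻¹ * (z - x))) ⊆ Metric.closedBall x (δ ^ 3) := by
  refine closure_minimal (fun z hz => ?_) Metric.isClosed_closedBall
  have hz' := hψ (subset_tsupport ψ (right_ne_zero_of_mul hz))
  rwa [mem_Icc, ← abs_le, abs_mul, abs_of_pos (inv_pos.2 (pow_pos hδ 3)), inv_mul_le_iff₀
    (pow_pos hδ 3), mul_one] at hz'

theorem tendsto_pow_three_nhdsGT_zero : Tendsto (fun δ : ℝ => δ ^ 3) (𝓝[>] 0) (𝓝[>] 0) :=
  tendsto_nhdsWithin_iff.2 ⟨((continuous_pow 3).tendsto' 0 0 (by simp)).mono_left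
    nhdsWithin_le_nhds, eventually_mem_nhdsWithin.mono fun _ hδ => mem_Ioi.2 (pow_pos hδ 3)⟩

theorem mul_mem_Icc_neg_self {δ r t : ℝ} (hδ : δ ∈ Ioo 0 r) (ht : |t| ≤ 1) :
    δ * t ∈ Icc (-r) r := by
  rw [mem_Icc, ← abs_le, abs_mul, abs_of_pos hδ.1]
  exact (mul_le_of_le_one_right hδ.1.le ht).trans hδ.2.le

theorem IsLebesguePoint.tendsto_integral_inner_spike (hx : IsLebesguePoint f x)
    (hf : IntegrableAtFilter f (𝓝 x)) {r : ℝ} (hr : 0 < r) (hG : ContinuousOn G (Icc (-r) r))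
    (hψ : ContDiff ℝ 1 ψ) (hψ₁ : ∀ z, |ψ z| ≤ 1) (hψs : HasCompactSupport ψ) :
    Tendsto (fun δ => ∫ z in (-1)..1, ⟪deriv ψ z ^ 2 • G (δ * ψ z), f (x + δ ^ 3 * z)⟫_ℝ) (𝓝[>] 0)
      (𝓝 (∫ z in (-1)..1, ⟪deriv ψ z ^ 2 • G 0, f x⟫_ℝ)) := by
  have hψ' : Continuous (deriv ψ) := hψ.continuous_deriv le_rfl
  obtain ⟨M, hM⟩ := isCompact_Icc.exists_bound_of_continuousOn hG
  obtain ⟨D, hD⟩ := hψs.deriv.exists_bound_of_continuous hψ'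
  refine hx.tendsto_integral_inner hf tendsto_pow_three_nhdsGT_zero (C := D ^ 2 * M) ?_ fun z => ?_
  · filter_upwards [Ioo_mem_nhdsGT hr] with δ hδ
    have hrange (z : ℝ) : δ * ψ z ∈ Icc (-r) r := mul_mem_Icc_neg_self hδ (hψ₁ z)
    refine ⟨(hψ'.pow 2).smul (hG.comp_continuous (by fun_prop) hrange), fun z => ?_⟩
    rw [norm_smul, norm_pow]
    gcongr
    exacts [hD z, hM _ (hrange z)]
  · have hG₀ : ContinuousAt G (0 * ψ z) := by
      rw [zero_mul]
      exact hG.continuousAt (Icc_mem_nhds (neg_lt_zero.2 hr) hr)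
    have hmul : Tendsto (fun δ => δ * ψ z) (𝓝[>] 0) (𝓝 (0 * ψ z)) :=
      (tendsto_id.mono_left nhdsWithin_le_nhds).mul_const _
    simpa using (hG₀.tendsto.comp hmul).const_smul (deriv ψ z ^ 2)

/-- The spikes `δ ψ((z - x) / δ³)` tend to `0` uniformly, while their energy `δ⁻¹ ∫ ψ'²` blows up
and concentrates at `x`; no bounded contribution `C` can therefore compensate it. -/
theorem IsLebesguePoint.inner_nonneg_of_forall_nonneg (hx : IsLebesguePoint f x)
    (hf : IntegrableAtFilter f (𝓝 x)) {r C : ℝ} {N : Set ℝ} (hr : 0 < r)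
    (hG : ContinuousOn G (Icc (-r) r)) (hN : N ∈ 𝓝 x)
    (hC : ∀ θ : ℝ → ℝ, ContDiff ℝ 1 θ → tsupport θ ⊆ N → (∀ z, θ z ∈ Icc (-r) r) →
      0 ≤ C + ∫ z, deriv θ z ^ 2 * ⟪G (θ z), f z⟫_ℝ) : 0 ≤ ⟪G 0, f x⟫_ℝ := by
  obtain ⟨ψ, hψ, hψ₁, hψs, hψ'⟩ := exists_bump_profile
  have hlim := hx.tendsto_integral_inner_spike hf hr hG hψ hψ₁
    (.of_support_subset_isCompact isCompact_Icc (subset_closure.trans hψs))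
  have hδC : Tendsto (fun δ : ℝ => δ * C) (𝓝[>] 0) (𝓝 0) := by
    simpa using (tendsto_id (x := 𝓝[>] (0 : ℝ))).mono_right nhdsWithin_le_nhds |>.mul_const C
  obtain ⟨ρ, hρ, hρN⟩ := Metric.nhds_basis_closedBall.mem_iff.1 hN
  have hnonneg : 0 ≤ ∫ z in (-1)..1, ⟪deriv ψ z ^ 2 • G 0, f x⟫_ℝ := by
    refine ge_of_tendsto (by simpa using hδC.add hlim) ?_
    filter_upwards [Ioo_mem_nhdsGT hr, tendsto_pow_three_nhdsGT_zero.eventually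
      (Ioo_mem_nhdsGT hρ)] with δ hδ hδρ
    rw [← mul_integral_deriv_spike_sq_mul_inner hδ.1 hψs, ← mul_add]
    exact mul_nonneg hδ.1.le (hC _ (by fun_prop) ((tsupport_spike_subset hδ.1 hψs).trans
      ((Metric.closedBall_subset_closedBall hδρ.2.le).trans hρN))
      fun z => mul_mem_Icc_neg_self hδ (hψ₁ _))
  simp only [real_inner_smul_left, intervalIntegral.integral_mul_const] at hnonneg
  exact nonneg_of_mul_nonneg_right hnonneg hψ'

end Concentration

section TestFunctions

variable {m : ℕ} {φ : ℝ → ℝ} {I : Set ℝ} {u w : ℝ → EuclideanSpace ℂ (Fin m)}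
  {B : ℝ → Matrix (Fin m) (Fin m) ℂ}

theorem real_inner_eq_re (x y : EuclideanSpace ℂ (Fin m)) : ⟪x, y⟫_ℝ = (inner ℂ x y).re := by
  simp [PiLp.inner_apply, Complex.inner]

theorem locallyIntegrableOn_sum_smul {ι 𝕜 E : Type*} [RCLike 𝕜] [NormedAddCommGroup E]
    [NormedSpace 𝕜 E] (hI : IsOpen I) (s : Finset ι) {f : ι → ℝ → 𝕜}
    (hf : ∀ i, LocallyIntegrableOn (f i) I) (c : ι → E) :
    LocallyIntegrableOn (fun x => ∑ i ∈ s, f i x • c i) I := by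
  refine (locallyIntegrableOn_iff hI.isLocallyClosed).2 fun K hKI hK => ?_
  exact integrable_finsetSum _ fun i _ =>
    ((hf i).integrableOn_compact_subset hKI hK).smul_const (c i)

theorem locallyIntegrableOn_toEuclideanCLM (hI : IsOpen I)
    (hB : ∀ i j, LocallyIntegrableOn (fun x => B x i j) I) :
    LocallyIntegrableOn (fun x => Matrix.toEuclideanCLM (𝕜 := ℂ) (B x)) I := by
  have hsum (x : ℝ) : Matrix.toEuclideanCLM (𝕜 := ℂ) (B x) = ∑ ij : Fin m × Fin m,
      B x ij.1 ij.2 • Matrix.toEuclideanCLM (𝕜 := ℂ) (Matrix.single ij.1 ij.2 1) := by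
    conv_lhs => rw [Matrix.matrix_eq_sum_single (B x)]
    simp only [map_sum, ← map_smul, Matrix.smul_single, smul_eq_mul, mul_one,
      Fintype.sum_prod_type]
  rw [funext hsum]
  exact locallyIntegrableOn_sum_smul hI _ (fun ij : Fin m × Fin m => hB ij.1 ij.2) _

theorem IsC1c.of_support_subset (hu : IsC1c I u) (hw : ContDiff ℝ 1 w)
    (hwu : Function.support w ⊆ Function.support u) : IsC1c I w :=
  ⟨hw, hu.2.1.mono hwu, (closure_mono hwu).trans hu.2.2⟩

theorem support_radialMap_comp_subset :
    Function.support (radialMap φ ∘ u) ⊆ Function.support u := fun x hx hux =>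
  hx (by simp [radialMap, hux])

theorem IsC1c.deriv_eq_zero_of_notMem (hu : IsC1c I u) {x : ℝ} (hx : x ∉ I) : deriv u x = 0 :=
  image_eq_zero_of_notMem_tsupport
    (mt (@tsupport_deriv_subset ℝ _ _ _ _ u x) (mt (@hu.2.2 x) hx))

theorem IsC1c.integrable_inner_deriv (hI : IsOpen I)
    (hB : ∀ i j, LocallyIntegrableOn (fun x => B x i j) I) (hu : IsC1c I u)
    (hw : ContDiff ℝ 1 w) :
    Integrable fun x => inner ℂ (deriv w x) (Matrix.toEuclideanLin (B x) (deriv u x)) := by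
  have hK : IsCompact (tsupport u) := hu.2.1
  refine (integrableOn_iff_integrable_of_support_subset fun x hx => ?_).1
    (integrableOn_inner hK (hw.continuous_deriv le_rfl) (integrableOn_clm_apply hK
      ((locallyIntegrableOn_toEuclideanCLM hI hB).integrableOn_compact_subset hu.2.2 hK)
      (hu.1.continuous_deriv le_rfl)))
  refine tsupport_deriv_subset (subset_tsupport _ fun hx₀ => hx ?_)
  simp only [hx₀, map_zero, inner_zero_right]

theorem IsC1c.integrable_real_inner_deriv (hI : IsOpen I)
    (hB : ∀ i j, LocallyIntegrableOn (fun x => B x i j) I) (hu : IsC1c I u)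
    (hw : ContDiff ℝ 1 w) :
    Integrable fun x => ⟪deriv w x, Matrix.toEuclideanLin (B x) (deriv u x)⟫_ℝ := by
  simp only [real_inner_eq_re]
  exact (hu.integrable_inner_deriv hI hB hw).re

theorem isLPhiDissipative_iff_integral (hI : IsOpen I)
    (hB : ∀ i j, LocallyIntegrableOn (fun x => B x i j) I) :
    IsLPhiDissipative φ I B ↔ ∀ u, IsC1c I u → IsC1c I (radialMap φ ∘ u) →
      0 ≤ ∫ x, ⟪deriv (radialMap φ ∘ u) x, Matrix.toEuclideanLin (B x) (deriv u x)⟫_ℝ := by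
  refine forall_congr' fun u => imp_congr_right fun hu => imp_congr_right fun hw => ?_
  have hre : (∫ x in I, inner ℂ (deriv (radialMap φ ∘ u) x)
      (Matrix.toEuclideanLin (B x) (deriv u x))).re =
      ∫ x, ⟪deriv (radialMap φ ∘ u) x, Matrix.toEuclideanLin (B x) (deriv u x)⟫_ℝ := by
    rw [setIntegral_eq_integral_of_forall_compl_eq_zero fun x hx => by
      rw [hu.deriv_eq_zero_of_notMem hx, map_zero, inner_zero_right]]
    simp only [real_inner_eq_re]
    exact (integral_re (hu.integrable_inner_deriv hI hB hw.1)).symm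
  exact iff_of_eq (congrArg (0 ≤ ·) hre)

theorem exists_isC1c_eventuallyEq (h : IsRegularWeight φ) (hI : IsOpen I) {x : ℝ} (hx : x ∈ I)
    {y : EuclideanSpace ℂ (Fin m)} (hy : y ≠ 0) :
    ∃ u, IsC1c I u ∧ IsC1c I (radialMap φ ∘ u) ∧ u =ᶠ[𝓝 x] fun _ => y := by
  obtain ⟨g, hg, hg₀, hgφ⟩ := h.exists_contDiff_add_mul_eq_sq
  obtain ⟨ρ, hρ, hρI⟩ := Metric.nhds_basis_closedBall.mem_iff.1 (hI.mem_nhds hx)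
  let f : ContDiffBump x := ⟨ρ / 2, ρ, by positivity, by linarith⟩
  have hy' : 0 < ‖y‖ := norm_pos_iff.2 hy
  have hφy := h.pos hy'
  let w : EuclideanSpace ℂ (Fin m) := ‖y‖⁻¹ • y
  have hw : ‖w‖ = 1 := norm_smul_inv_norm (𝕜 := ℝ) hy
  let c : ℝ := √(‖y‖ + ‖y‖ * φ ‖y‖)
  have hgc : g c = ‖y‖ := h.injOn_add_id_mul (hg₀ c) hy'.le (by
    simp only [hgφ, c, Real.sq_sqrt (add_pos hy' (mul_pos hy' hφy)).le])
  have hgzero : g 0 = 0 := h.injOn_add_id_mul (hg₀ 0) self_mem_Ici (by simp [hgφ])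
  have hf : ContDiff ℝ 1 f := f.contDiff
  have hu : ContDiff ℝ 1 fun z => g (c * f z) • w := by fun_prop
  have hφu : radialMap φ ∘ (fun z => g (c * f z) • w) =
      fun z => ((c * f z) ^ 2 - g (c * f z)) • w := by
    funext z
    rw [Function.comp_apply, radialMap, norm_smul, hw, mul_one, Real.norm_of_nonneg (hg₀ _),
      smul_smul, ← hgφ (c * f z)]
    congr 1
    ring
  have hsupp : IsC1c I fun z => g (c * f z) • w := by
    have hfu : Function.support (fun z => g (c * f z) • w) ⊆ Function.support f :=
      fun z hz hfz => hz (by simp [hfz, hgzero])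
    exact ⟨hu, f.hasCompactSupport.mono hfu,
      (closure_mono hfu).trans (f.tsupport_eq.trans_subset hρI)⟩
  refine ⟨_, hsupp, hsupp.of_support_subset ?_ support_radialMap_comp_subset, ?_⟩
  · rw [hφu]
    fun_prop
  · filter_upwards [f.eventuallyEq_one] with z hz
    rw [hz, Pi.one_apply, mul_one, hgc, smul_inv_smul₀ hy'.ne']

end TestFunctions

section Dissipativity

variable {m : ℕ} {φ : ℝ → ℝ} {I N : Set ℝ} {u : ℝ → EuclideanSpace ℂ (Fin m)}
  {B : ℝ → Matrix (Fin m) (Fin m) ℂ} {y v : EuclideanSpace ℂ (Fin m)} {θ : ℝ → ℝ}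

theorem IsLPhiDissipative.integral_add_integral_deriv_sq_mul_nonneg
    (hdiss : IsLPhiDissipative φ I B) (h : IsRegularWeight φ) (hI : IsOpen I)
    (hB : ∀ i j, LocallyIntegrableOn (fun x => B x i j) I) (hu : IsC1c I u)
    (hw : ContDiff ℝ 1 (radialMap φ ∘ u)) (hy : y ≠ 0) (hN : IsOpen N) (huN : ∀ x ∈ N, u x = y)
    (hθ : ContDiff ℝ 1 θ) (hθN : tsupport θ ⊆ N) (hne : ∀ x, y + θ x • v ≠ 0) :
    0 ≤ (∫ x, ⟪deriv (radialMap φ ∘ u) x, Matrix.toEuclideanLin (B x) (deriv u x)⟫_ℝ) +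
      ∫ x, deriv θ x ^ 2 * ⟪fderiv ℝ (radialMap φ) (y + θ x • v) v,
        Matrix.toEuclideanLin (B x) v⟫_ℝ := by
  have hsupp : Function.support (fun x => u x + θ x • v) ⊆ Function.support u := by
    intro x hx hux
    have hxN : x ∉ N := fun hxN => hy (by rw [← huN x hxN, hux])
    have hθx : θ x = 0 := image_eq_zero_of_notMem_tsupport (mt (@hθN x) hxN)
    simp [hux, hθx] at hx
  have hU : IsC1c I fun x => u x + θ x • v :=
    hu.of_support_subset (hu.1.add (hθ.smul contDiff_const)) hsupp
  have hW := h.contDiff_radialMap_add_smul hw hN huN hθ hθN hne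
  have hdensity (x : ℝ) := h.inner_deriv_radialMap_add_smul hN huN
    (hθ.differentiable one_ne_zero) hθN hne
    ((Matrix.toEuclideanLin (B x)).restrictScalars ℝ) x
  simp only [LinearMap.coe_restrictScalars] at hdensity
  have hintU := hU.integrable_real_inner_deriv hI hB hW
  have hintu := hu.integrable_real_inner_deriv hI hB hw
  rw [← integral_add hintu ((hintU.sub hintu).congr (.of_forall fun x => by
    simp only [Pi.sub_apply, hdensity x, add_sub_cancel_left]))]
  simp only [← hdensity]
  exact (isLPhiDissipative_iff_integral hI hB).1 hdiss _ hU
    (hU.of_support_subset hW support_radialMap_comp_subset)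

theorem IsLPhiDissipative.isRadiallyAccretive (hdiss : IsLPhiDissipative φ I B)
    (h : IsRegularWeight φ) (hI : IsOpen I)
    (hB : ∀ i j, LocallyIntegrableOn (fun x => B x i j) I) {x : ℝ} (hx : x ∈ I)
    (hxB : IsLebesguePoint (fun x => Matrix.toEuclideanCLM (𝕜 := ℂ) (B x)) x) :
    IsRadiallyAccretive φ (Matrix.toEuclideanLin (B x)) := by
  intro y hy v
  obtain ⟨u, hu, hw, huy⟩ := exists_isC1c_eventuallyEq h hI hx hy
  obtain ⟨N, hNu, hN, hxN⟩ := eventually_nhds_iff.1 huy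
  obtain ⟨r, hr, hne⟩ : ∃ r : ℝ, 0 < r ∧ ∀ t ∈ Icc (-r) r, y + t • v ≠ 0 := by
    have hcont : Continuous fun t : ℝ => y + t • v := by fun_prop
    have hev : ∀ᶠ t in 𝓝 (0 : ℝ), y + t • v ≠ 0 :=
      hcont.continuousAt.eventually_ne (by simpa using hy)
    obtain ⟨r, hr, hball⟩ := Metric.nhds_basis_closedBall.eventually_iff.1 hev
    exact ⟨r, hr, fun t ht => hball (by rwa [Real.closedBall_eq_Icc, zero_sub, zero_add])⟩
  have hG : ContinuousOn (fun t : ℝ => fderiv ℝ (radialMap φ) (y + t • v) v) (Icc (-r) r) := by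
    refine ContinuousOn.clm_apply (fun t ht => ContinuousAt.continuousWithinAt ?_)
      continuousOn_const
    exact ((h.contDiffAt_radialMap (hne t ht)).continuousAt_fderiv one_ne_zero).comp
      (f := fun t : ℝ => y + t • v) (by fun_prop)
  have hT : IntegrableAtFilter (fun x => Matrix.toEuclideanCLM (𝕜 := ℂ) (B x)) (𝓝 x) :=
    hI.nhdsWithin_eq hx ▸ locallyIntegrableOn_toEuclideanCLM hI hB x hx
  have hTv : IntegrableAtFilter (fun x => Matrix.toEuclideanCLM (𝕜 := ℂ) (B x) v) (𝓝 x) :=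
    let ⟨s, hs, hTs⟩ := hT
    ⟨s, hs, hTs.apply_continuousLinearMap v⟩
  have := (hxB.clm_apply hT v).inner_nonneg_of_forall_nonneg hTv hr hG (hN.mem_nhds hxN)
    fun θ hθ hθN hθr => hdiss.integral_add_integral_deriv_sq_mul_nonneg h hI hB hu hw.1 hy hN hNu
      hθ hθN fun z => hne _ (hθr z)
  simpa using! this

theorem isLPhiDissipative_iff_ae (h : IsRegularWeight φ) (hI : IsOpen I)
    (hB : ∀ i j, LocallyIntegrableOn (fun x => B x i j) I) :
    IsLPhiDissipative φ I B ↔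
      ∀ᵐ x ∂volume.restrict I, IsRadiallyAccretive φ (Matrix.toEuclideanLin (B x)) := by
  constructor
  · intro hdiss
    filter_upwards [ae_restrict_mem hI.measurableSet,
      ae_isLebesguePoint hI (locallyIntegrableOn_toEuclideanCLM hI hB)] with x hxI hx
    exact hdiss.isRadiallyAccretive h hI hB hxI hx
  · intro hacc
    rw [ae_restrict_iff' hI.measurableSet] at hacc
    refine (isLPhiDissipative_iff_integral hI hB).2 fun u hu _ => integral_nonneg_of_ae ?_
    filter_upwards [hacc, ae_deriv_eq_zero_of_eq u 0] with x hx hux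
    by_cases hxI : x ∈ I
    swap
    · simp [hu.deriv_eq_zero_of_notMem hxI]
    rcases eq_or_ne (u x) 0 with hu₀ | hu₀
    · simp [hux hu₀]
    have hradial := ((h.contDiffAt_radialMap hu₀).differentiableAt one_ne_zero).hasFDerivAt
    have hderiv := (hu.1.differentiable one_ne_zero x).hasDerivAt
    rw [(hradial.comp_hasDerivAt x hderiv).deriv]
    exact hx hxI _ hu₀ _

end Dissipativity

section Matrices

variable {m : ℕ} {M : Matrix (Fin m) (Fin m) ℝ}

theorem nonempty_setOf_hasEigenvalue (hm : 1 ≤ m) (hM : M.IsSymm) :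
    {μ | Module.End.HasEigenvalue (Matrix.toLin' M) μ}.Nonempty := by
  have hM' : M.IsHermitian := by
    rwa [Matrix.IsHermitian, Matrix.conjTranspose_eq_transpose_of_trivial]
  refine ⟨hM'.eigenvalues ⟨0, hm⟩, ?_⟩
  rw [mem_ofPred_eq, Module.End.hasEigenvalue_iff_mem_spectrum, Matrix.spectrum_toLin']
  exact hM'.eigenvalues_mem_spectrum_real _

theorem isLeast_minEigenvalue (hm : 1 ≤ m) (hM : M.IsSymm) :
    IsLeast {μ | Module.End.HasEigenvalue (Matrix.toLin' M) μ} (minEigenvalue M) :=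
  have hfin := Module.End.finite_hasEigenvalue (Matrix.toLin' M)
  ⟨(nonempty_setOf_hasEigenvalue hm hM).csInf_mem hfin, fun _ hμ => csInf_le hfin.bddBelow hμ⟩

theorem isGreatest_maxEigenvalue (hm : 1 ≤ m) (hM : M.IsSymm) :
    IsGreatest {μ | Module.End.HasEigenvalue (Matrix.toLin' M) μ} (maxEigenvalue M) :=
  have hfin := Module.End.finite_hasEigenvalue (Matrix.toLin' M)
  ⟨(nonempty_setOf_hasEigenvalue hm hM).csSup_mem hfin, fun _ hμ => le_csSup hfin.bddAbove hμ⟩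

theorem hasEigenvalue_toLin'_sub_smul_one_iff {κ μ : ℝ} :
    Module.End.HasEigenvalue (Matrix.toLin' (M - κ • (1 : Matrix (Fin m) (Fin m) ℝ))) μ ↔
      Module.End.HasEigenvalue (Matrix.toLin' M) (μ + κ) := by
  have : Module.End.eigenspace (Matrix.toLin' (M - κ • (1 : Matrix (Fin m) (Fin m) ℝ))) μ =
      Module.End.eigenspace (Matrix.toLin' M) (μ + κ) := by
    ext v
    simp [sub_eq_iff_eq_add, add_smul]
  rw [Module.End.hasEigenvalue_iff, Module.End.hasEigenvalue_iff, this]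

theorem minEigenvalue_sub_smul_one (hm : 1 ≤ m) (hM : M.IsSymm) (κ : ℝ) :
    minEigenvalue (M - κ • (1 : Matrix (Fin m) (Fin m) ℝ)) = minEigenvalue M - κ := by
  have hleast := isLeast_minEigenvalue hm hM
  simp only [minEigenvalue, hasEigenvalue_toLin'_sub_smul_one_iff]
  refine IsLeast.csInf_eq ⟨?_, fun μ hμ => sub_le_iff_le_add.2 (hleast.2 hμ)⟩
  simpa [minEigenvalue] using hleast.1

theorem maxEigenvalue_sub_smul_one (hm : 1 ≤ m) (hM : M.IsSymm) (κ : ℝ) :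
    maxEigenvalue (M - κ • (1 : Matrix (Fin m) (Fin m) ℝ)) = maxEigenvalue M - κ := by
  have hgreatest := isGreatest_maxEigenvalue hm hM
  simp only [maxEigenvalue, hasEigenvalue_toLin'_sub_smul_one_iff]
  refine IsGreatest.csSup_eq ⟨?_, fun μ hμ => le_sub_iff_add_le.2 (hgreatest.2 hμ)⟩
  simpa [maxEigenvalue] using hgreatest.1

theorem setOf_hasEigenvalue_fin_two {M : Matrix (Fin 2) (Fin 2) ℝ} (hM : M.IsSymm) :
    {μ | Module.End.HasEigenvalue (Matrix.toLin' M) μ} =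
      {(M.trace - √(M.trace ^ 2 - 4 * M.det)) / 2, (M.trace + √(M.trace ^ 2 - 4 * M.det)) / 2} := by
  have hdisc : 0 ≤ M.trace ^ 2 - 4 * M.det := by
    rw [Matrix.trace_fin_two, Matrix.det_fin_two, hM.apply 0 1]
    nlinarith [sq_nonneg (M 0 0 - M 1 1), sq_nonneg (M 0 1)]
  have hsqrt := Real.sq_sqrt hdisc
  ext μ
  have hfactor : μ ^ 2 - M.trace * μ + M.det =
      (μ - (M.trace - √(M.trace ^ 2 - 4 * M.det)) / 2) *
        (μ - (M.trace + √(M.trace ^ 2 - 4 * M.det)) / 2) := by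
    linear_combination hsqrt / 4
  rw [mem_ofPred_eq, Module.End.hasEigenvalue_iff_isRoot_charpoly, Matrix.charpoly_toLin',
    Matrix.charpoly_fin_two, mem_insert_iff, mem_singleton_iff, ← sub_eq_zero,
    ← sub_eq_zero (b := (M.trace + _) / 2), ← mul_eq_zero, ← hfactor]
  simp

theorem one_add_mul_minEigenvalue_sub_one_sub_mul_maxEigenvalue {M : Matrix (Fin 2) (Fin 2) ℝ}
    (hM : M.IsSymm) (s : ℝ) :
    (1 + s) * minEigenvalue M - (1 - s) * maxEigenvalue M =
      s * M.trace - √(M.trace ^ 2 - 4 * M.det) := by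
  have hle : (M.trace - √(M.trace ^ 2 - 4 * M.det)) / 2 ≤
      (M.trace + √(M.trace ^ 2 - 4 * M.det)) / 2 := by
    linarith [Real.sqrt_nonneg (M.trace ^ 2 - 4 * M.det)]
  rw [minEigenvalue, maxEigenvalue, setOf_hasEigenvalue_fin_two hM, csInf_pair, csSup_pair,
    min_eq_left hle, max_eq_right hle]
  ring

theorem map_ofReal_sub_smul_one (M : Matrix (Fin m) (Fin m) ℝ) (κ : ℝ) :
    M.map Complex.ofReal - (κ : ℂ) • (1 : Matrix (Fin m) (Fin m) ℂ) =
      (M - κ • (1 : Matrix (Fin m) (Fin m) ℝ)).map Complex.ofReal := by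
  ext i j
  by_cases hij : i = j <;> simp [hij]

theorem isSymmetric_restrictScalars_toEuclideanLin (hM : M.IsSymm) :
    ((Matrix.toEuclideanLin (M.map Complex.ofReal)).restrictScalars ℝ).IsSymmetric := by
  have hM' : (M.map Complex.ofReal).IsHermitian := by
    ext i j
    simp [hM.apply i j]
  intro x y
  rw [real_inner_eq_re, real_inner_eq_re]
  exact congrArg Complex.re (Matrix.isSymmetric_toEuclideanLin_iff.2 hM' x y)

theorem hasEigenvalue_restrictScalars_toEuclideanLin_iff {μ : ℝ} :
    Module.End.HasEigenvalue
        ((Matrix.toEuclideanLin (M.map Complex.ofReal)).restrictScalars ℝ) μ ↔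
      Module.End.HasEigenvalue (Matrix.toLin' M) μ := by
  have hscalars : Module.End.HasEigenvalue
      ((Matrix.toEuclideanLin (M.map Complex.ofReal)).restrictScalars ℝ) μ ↔
        Module.End.HasEigenvalue (Matrix.toEuclideanLin (M.map Complex.ofReal)) (μ : ℂ) := by
    simp [Module.End.hasEigenvalue_iff, Submodule.ne_bot_iff]
  rw [hscalars, Module.End.hasEigenvalue_iff_mem_spectrum, Matrix.spectrum_toLpLin,
    Matrix.mem_spectrum_iff_isRoot_charpoly, Module.End.hasEigenvalue_iff_isRoot_charpoly,
    Matrix.charpoly_toLin', ← Polynomial.isRoot_map_iff Complex.ofRealHom.injective,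
    ← Matrix.charpoly_map]
  rfl

theorem isRadiallyAccretive_toEuclideanLin_map_ofReal_iff {φ : ℝ → ℝ} (h : IsRegularWeight φ)
    (hΛ : LambdaInftySq φ < 1) (hm : 1 ≤ m) (hM : M.IsSymm) :
    IsRadiallyAccretive φ (Matrix.toEuclideanLin (M.map Complex.ofReal)) ↔
      0 ≤ (1 + √(1 - LambdaInftySq φ)) * minEigenvalue M -
        (1 - √(1 - LambdaInftySq φ)) * maxEigenvalue M := by
  have := isRadiallyAccretive_iff (p := minEigenvalue M) (q := maxEigenvalue M) h hΛ
    (isSymmetric_restrictScalars_toEuclideanLin hM)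
    (by simpa only [hasEigenvalue_restrictScalars_toEuclideanLin_iff] using
      isLeast_minEigenvalue hm hM)
    (by simpa only [hasEigenvalue_restrictScalars_toEuclideanLin_iff] using
      isGreatest_maxEigenvalue hm hM)
  rwa [LinearMap.coe_restrictScalars] at this

end Matrices

section Main

variable {m : ℕ} {φ : ℝ → ℝ} {I : Set ℝ} {A : ℝ → Matrix (Fin m) (Fin m) ℝ}

theorem zero_lt_essInfOn_iff {f : ℝ → ℝ} :
    0 < essInfOn I f ↔ ∃ c : ℝ, 0 < c ∧ ∀ᵐ x ∂volume.restrict I, c ≤ f x := by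
  constructor
  · intro hf
    obtain ⟨c, hc₀, hc⟩ := EReal.lt_iff_exists_real_btwn.1 hf
    exact ⟨c, EReal.coe_pos.1 hc₀,
      (ae_lt_of_lt_essInf hc).mono fun x hx => (EReal.coe_lt_coe_iff.1 hx).le⟩
  · rintro ⟨c, hc, hf⟩
    exact (EReal.coe_pos.2 hc).trans_le
      (le_essInf_of_ae_le _ (hf.mono fun x hx => EReal.coe_le_coe_iff.2 hx))

theorem isOpen_openInterval (a b : EReal) : IsOpen (openInterval a b) :=
  isOpen_Ioo.preimage continuous_coe_real_ereal

theorem locallyIntegrableOn_map_ofReal_sub_smul_one (hI : IsOpen I)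
    (hA : ∀ i j, LocallyIntegrableOn (fun x => A x i j) I) (κ : ℝ) (i j : Fin m) :
    LocallyIntegrableOn
      (fun x => (A x - κ • (1 : Matrix (Fin m) (Fin m) ℝ)).map Complex.ofReal i j) I := by
  refine (locallyIntegrableOn_iff hI.isLocallyClosed).2 fun K hKI hK => ?_
  exact (((hA i j).sub (locallyIntegrableOn_const
    ((κ • (1 : Matrix (Fin m) (Fin m) ℝ)) i j))).integrableOn_compact_subset hKI hK).ofReal

theorem isLPhiDissipative_sub_smul_one_iff (h : IsRegularWeight φ) (hΛ : LambdaInftySq φ < 1)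
    (hI : IsOpen I) (hm : 1 ≤ m) (hA : ∀ i j, LocallyIntegrableOn (fun x => A x i j) I)
    (hsymm : ∀ᵐ x ∂volume.restrict I, (A x).IsSymm) (κ : ℝ) :
    IsLPhiDissipative φ I
        (fun x => (A x).map Complex.ofReal - (κ : ℂ) • (1 : Matrix (Fin m) (Fin m) ℂ)) ↔
      ∀ᵐ x ∂volume.restrict I, 2 * √(1 - LambdaInftySq φ) * κ ≤
        (1 + √(1 - LambdaInftySq φ)) * minEigenvalue (A x) -
          (1 - √(1 - LambdaInftySq φ)) * maxEigenvalue (A x) := by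
  simp only [map_ofReal_sub_smul_one]
  rw [isLPhiDissipative_iff_ae h hI (locallyIntegrableOn_map_ofReal_sub_smul_one hI hA κ)]
  refine Filter.eventually_congr (hsymm.mono fun x hx => ?_)
  rw [isRadiallyAccretive_toEuclideanLin_map_ofReal_iff h hΛ hm
    (hx.sub (Matrix.isSymm_one.smul κ)), minEigenvalue_sub_smul_one hm hx,
    maxEigenvalue_sub_smul_one hm hx, ← sub_nonneg (b := 2 * _ * κ)]
  ring_nf

theorem mainTheorem9_general (h : IsRegularWeight φ) (hΛ : LambdaInftySq φ < 1) (hI : IsOpen I)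
    (hm : 1 ≤ m) (hA : ∀ i j, LocallyIntegrableOn (fun x => A x i j) I)
    (hsymm : ∀ᵐ x ∂volume.restrict I, (A x).IsSymm) :
    ((∃ κ : ℝ, 0 < κ ∧ IsLPhiDissipative φ I
        (fun x => (A x).map Complex.ofReal - (κ : ℂ) • (1 : Matrix (Fin m) (Fin m) ℂ))) ↔
      0 < essInfOn I (fun x => (1 + √(1 - LambdaInftySq φ)) * minEigenvalue (A x) -
        (1 - √(1 - LambdaInftySq φ)) * maxEigenvalue (A x))) ∧
    (m = 2 →
      (0 < essInfOn I (fun x => (1 + √(1 - LambdaInftySq φ)) * minEigenvalue (A x) -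
          (1 - √(1 - LambdaInftySq φ)) * maxEigenvalue (A x)) ↔
        0 < essInfOn I (fun x => √(1 - LambdaInftySq φ) * (A x).trace -
          √((A x).trace ^ 2 - 4 * (A x).det)))) := by
  constructor
  · have hτ : 0 < 2 * √(1 - LambdaInftySq φ) := mul_pos two_pos (Real.sqrt_pos.2 (by linarith))
    simp only [isLPhiDissipative_sub_smul_one_iff h hΛ hI hm hA hsymm, zero_lt_essInfOn_iff]
    constructor
    · rintro ⟨κ, hκ, hae⟩
      exact ⟨_, mul_pos hτ hκ, hae⟩
    · rintro ⟨c, hc, hae⟩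
      exact ⟨c / (2 * √(1 - LambdaInftySq φ)), div_pos hc hτ, by rwa [mul_div_cancel₀ _ hτ.ne']⟩
  · rintro rfl
    refine iff_of_eq (congrArg (0 < ·) (essInf_congr_ae (hsymm.mono fun x hx => ?_)))
    exact congrArg Real.toEReal (one_add_mul_minEigenvalue_sub_one_sub_mul_maxEigenvalue hx _)

end Main

end FunctionalDissipativity

theorem mainTheorem9
    (φ : ℝ → ℝ) (hφ : FunctionalDissipativity.IsAdmissible φ)
    (hΛ : FunctionalDissipativity.LambdaInftySq φ < 1)
    (a b : EReal) (hab : a < b)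
    (m : ℕ) (hm : 1 ≤ m)
    (A : ℝ → Matrix (Fin m) (Fin m) ℝ)
    (hA : ∀ i j, LocallyIntegrableOn (fun x => A x i j)
      (FunctionalDissipativity.openInterval a b) volume)
    (hsymm : ∀ᵐ x ∂(volume.restrict (FunctionalDissipativity.openInterval a b)), (A x).IsSymm) :
    ((∃ κ : ℝ, 0 < κ ∧
        FunctionalDissipativity.IsLPhiDissipative φ (FunctionalDissipativity.openInterval a b)
          (fun x => (A x).map Complex.ofReal - (κ : ℂ) • (1 : Matrix (Fin m) (Fin m) ℂ))) ↔
      0 < FunctionalDissipativity.essInfOn (FunctionalDissipativity.openInterval a b)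
        (fun x =>
          (1 + √(1 - FunctionalDissipativity.LambdaInftySq φ)) *
              FunctionalDissipativity.minEigenvalue (A x) -
            (1 - √(1 - FunctionalDissipativity.LambdaInftySq φ)) *
              FunctionalDissipativity.maxEigenvalue (A x))) ∧
    (m = 2 →
      (0 < FunctionalDissipativity.essInfOn (FunctionalDissipativity.openInterval a b)
          (fun x =>
            (1 + √(1 - FunctionalDissipativity.LambdaInftySq φ)) *
                FunctionalDissipativity.minEigenvalue (A x) -
              (1 - √(1 - FunctionalDissipativity.LambdaInftySq φ)) *
                FunctionalDissipativity.maxEigenvalue (A x)) ↔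
        0 < FunctionalDissipativity.essInfOn (FunctionalDissipativity.openInterval a b)
          (fun x =>
            √(1 - FunctionalDissipativity.LambdaInftySq φ) * (A x).trace -
              √((A x).trace ^ 2 - 4 * (A x).det)))) :=
  FunctionalDissipativity.mainTheorem9_general hφ.isRegularWeight hΛ
    (FunctionalDissipativity.isOpen_openInterval a b) hm hA hsymm
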